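/- A rooted labeled tree on $n\ge 1$ vertices is a tree with vertex set $\{1,\dots,n\}$ together with a distinguished vertex, the root; its total height is the sum, over all vertices, of the distance to the root. Let $H_n$ be the total height of a uniformly random rooted labeled tree on $n$ vertices, let $\mu_4(n)=\mathbb E\big[(H_n-\mathbb E H_n)^4\big]$ be its fourth moment about the mean, and put $$W_n=\frac{n!}{n^{n-1}}\sum_{k=0}^{n-2}\frac{n^k}{k!}.$$ **Theorem 4.** For every $n\ge 1$, $$\begin{aligned}\mu_4(n)={}&-3W_n^4-17\,n\,W_n^3+\Big(\tfrac52 n^3-\tfrac{217}{6}n^2+\tfrac1{15}n\Big)W_n^2\\ &+\Big(\tfrac{649}{80}n^4-\tfrac{74381}{2160}n^3+\tfrac{433}{2520}n^2+\tfrac1{105}n\Big)W_n\\ &+\tfrac{221}{63}n^6+\tfrac{4693}{540}n^5-\tfrac{4651}{378}n^4+\tfrac{109}{1260}n^3+\tfrac{2}{105}n^2 .\end{aligned}$$ As $n\to\infty$, $$\mu_4(n)\sim\Big(-\tfrac34\pi^2+\tfrac54\pi+\tfrac{221}{63}\Big)n^6 ,$$ where the constant is within $2\cdot10^{-9}$ of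 $0.032724023$. The kurtosis $\mu_4(n)/\operatorname{Var}(H_n)^2$ converges, as $n\to\infty$, to $$\frac17\cdot\frac{-189\pi^2+315\pi+884}{(10-3\pi)^2},$$ which is within $5\cdot10^{-5}$ of $3.5604$; in particular, the limiting kurtosis exceeds $3$ (leptokurtic). -/

import Mathlib

open ProbabilityTheory Filter Asymptotics
open scoped Nat

/-- A rooted labeled tree on the vertex set `Fin n`: a tree together with a distinguished
vertex, its root. -/
structure RootedLabeledTree (n : ℕ) where
  /-- the underlying tree, as a simple graph on the labels -/
  graph : SimpleGraph (Fin n)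
  /-- the distinguished vertex -/
  root : Fin n
  isTree : graph.IsTree

namespace RootedLabeledTree

/-- The total height: the sum over all vertices of the distance to the root. -/
noncomputable def totalHeight {n : ℕ} (T : RootedLabeledTree n) : ℕ :=
  ∑ v : Fin n, T.graph.dist T.root v

/-- Every set of rooted labeled trees is an event. -/
instance (n : ℕ) : MeasurableSpace (RootedLabeledTree n) := ⊤

/-- The uniform distribution on the (finite) set of rooted labeled trees on `n` vertices. -/
noncomputable def uniform (n : ℕ) : MeasureTheory.Measure (RootedLabeledTree n) :=
  uniformOn Set.univ

/-- The `k`-th moment about the mean of the total height of a uniformly random rooted labeled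
tree on `n` vertices. -/
noncomputable def heightCentralMoment (n k : ℕ) : ℝ :=
  centralMoment (fun T : RootedLabeledTree n => (T.totalHeight : ℝ)) k (uniform n)

/-- The kurtosis of the total height: the fourth moment about the mean divided by the square
of the variance. -/
noncomputable def heightKurtosis (n : ℕ) : ℝ :=
  heightCentralMoment n 4 /
    (variance (fun T : RootedLabeledTree n => (T.totalHeight : ℝ)) (uniform n)) ^ 2

/-- `W n = n! / n ^ (n - 1) * ∑_{k = 0}^{n - 2} n ^ k / k!` for `n ≥ 1` (an empty sum for
`n = 1`). -/
noncomputable def W (n : ℕ) : ℝ :=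
  (n ! : ℝ) / (n : ℝ) ^ (n - 1) * ∑ k ∈ Finset.range (n - 1), (n : ℝ) ^ k / (k ! : ℝ)

end RootedLabeledTree

/-!
Write `H` for the total height. Two steps give all moments of `H` exactly, and an integral gives
their growth.

*Branch recurrence.* Deleting the root of a rooted tree leaves a forest; call the vertex sets of
its components branches. A tree on `n` vertices with a marked vertex other than the root is the
same thing as a rooted tree on the branch `S` containing the mark, with the mark in it, and a
rooted tree on the complement of `S`, and `H = H₁ + |S| + H₂` because every vertex of `S` is one
step further from the new root (`PointedTree.sum_isBranch`). Hence `(n - 1) ∑ g(H)` is a binomial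
convolution (`PointedTree.branch_recurrence`). With `g(h) = h ^ j` this becomes a triangular system
of differential equations for the exponential generating functions `F j` of the `j`-th moments,
whose solution is unique (`PowerSeries.IsMomentSystem.unique`).

*Solution in the tree function.* Let `T = x e ^ T`. Lagrange inversion, in the form
`[x ^ n] g(T) = [w ^ n] g(w) (1 - w) e ^ (n w)`, defines a ring homomorphism `g ↦ g(T)` which
turns `w / (1 - w) d/dw` into `x d/dx` (`PowerSeries.lagrangeHom`). So it is enough to solve the
system in the variable `w`; the solution is `F 0 = T`, and for `1 ≤ j ≤ 4` an explicit polynomial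
in `1 / (1 - T)` (`PowerSeries.treeMoment`). The coefficients of the powers of `1 / (1 - T)` satisfy
a two-term recurrence, which leaves only `n ^ n / n!` and `∑_{k ≤ n} n ^ k / k!`; thus `E H ^ j`
is affine in `W n` with coefficients polynomial in `n` (`PointedTree.powerSum_eq`), with
`E H = W n`. The central moments follow by expansion.

*Asymptotics.* Ramanujan's integral `W n / n + 2 = ∫ e ^ (-t) (1 + t / n) ^ n dt` over `t > 0`,
rescaled by `t = s √n`, converges to the Gaussian integral by dominated convergence, so
`W n ∼ √(π / 2) n ^ (3 / 2)` (`RootedLabeledTree.tendsto_W_div`). Inserting this in the formulas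
for the variance and the fourth moment gives the remaining claims.
-/

/-! ### Distances in graphs, rooted trees and gluing -/

namespace SimpleGraph

variable {V W : Type*} {G : SimpleGraph V}

theorem Walk.le_add_length_of_adj {f : V → ℕ} (hf : ∀ x y, G.Adj x y → f y ≤ f x + 1)
    {x y : V} (p : G.Walk x y) : f y ≤ f x + p.length := by
  induction p with
  | nil => simp
  | cons h p ih =>
    have := hf _ _ h
    simp only [Walk.length_cons]
    lia

/-- A function that grows by at most one along each edge is a lower bound for the distance. -/
theorem Connected.le_add_dist_of_adj (hG : G.Connected) {f : V → ℕ}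
    (hf : ∀ x y, G.Adj x y → f y ≤ f x + 1) (x y : V) : f y ≤ f x + G.dist x y := by
  obtain ⟨p, hp⟩ := hG.exists_walk_length_eq_dist x y
  exact hp ▸ p.le_add_length_of_adj hf

theorem Connected.dist_le_dist_add_one (hG : G.Connected) (r : V) {x y : V} (h : G.Adj x y) :
    G.dist r y ≤ G.dist r x + 1 := by
  have := hG.dist_triangle (u := r) (v := x) (w := y)
  rwa [dist_eq_one_iff_adj.2 h] at this

theorem Connected.dist_map_le {H : SimpleGraph W} (hG : G.Connected) (f : G →g H) (x y : V) :
    H.dist (f x) (f y) ≤ G.dist x y := by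
  obtain ⟨p, hp⟩ := hG.exists_walk_length_eq_dist x y
  rw [← hp, ← Walk.length_map f p]
  exact dist_le _

theorem Connected.dist_iso {H : SimpleGraph W} (hG : G.Connected) (f : G ≃g H) (x y : V) :
    H.dist (f x) (f y) = G.dist x y := by
  refine le_antisymm (hG.dist_map_le f.toHom x y) ?_
  have h := (f.connected_iff.1 hG).dist_map_le f.symm.toHom (f x) (f y)
  have e1 : f.symm.toHom (f x) = x := f.symm_apply_apply x
  have e2 : f.symm.toHom (f y) = y := f.symm_apply_apply y
  rwa [e1, e2] at h

theorem reachable_map_of_adj {H : SimpleGraph W} (f : V → W)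
    (hf : ∀ x y, G.Adj x y → H.Reachable (f x) (f y)) {x y : V} (h : G.Reachable x y) :
    H.Reachable (f x) (f y) := by
  obtain ⟨p⟩ := h
  induction p with
  | nil => rfl
  | cons h _ ih => exact (hf _ _ h).trans ih

theorem Reachable.mem_of_adj {S : Set V} (hS : ∀ x y, G.Adj x y → x ∈ S → y ∈ S) {x y : V}
    (h : G.Reachable x y) (hx : x ∈ S) : y ∈ S := by
  obtain ⟨p⟩ := h
  induction p with
  | nil => exact hx
  | cons h _ ih => exact ih (hS _ _ h hx)

end SimpleGraph

/-- A tree on an arbitrary vertex type with a distinguished vertex. This is `RootedLabeledTree`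
with `Fin n` replaced by any type, so that trees on subsets of the labels make sense. -/
@[ext]
structure PointedTree (V : Type*) where
  /-- the underlying tree -/
  graph : SimpleGraph V
  /-- the distinguished vertex -/
  root : V
  isTree : graph.IsTree

namespace PointedTree

open SimpleGraph

variable {V W : Type*}

instance [Finite V] : Finite (PointedTree V) :=
  Finite.of_injective (fun T : PointedTree V => (T.graph, T.root)) fun T T' h => by
    rw [Prod.mk.injEq] at h
    exact PointedTree.ext h.1 h.2

noncomputable instance [Finite V] : Fintype (PointedTree V) := Fintype.ofFinite _

/-- The sum of the distances of all vertices to the root. -/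
noncomputable def height [Fintype V] (T : PointedTree V) : ℕ :=
  ∑ v : V, T.graph.dist T.root v

/-- Transport of a rooted tree along a bijection of the vertices. -/
def map (e : V ≃ W) (T : PointedTree V) : PointedTree W where
  graph := T.graph.comap e.symm
  root := e T.root
  isTree := (Iso.comap e.symm T.graph).isTree_iff.2 T.isTree

@[simp]
theorem map_symm_map (e : V ≃ W) (T : PointedTree V) : (T.map e).map e.symm = T := by
  ext <;> simp [map]

@[simp]
theorem map_map_symm (e : V ≃ W) (T : PointedTree W) : (T.map e.symm).map e = T :=
  map_symm_map e.symm T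

theorem height_map [Fintype V] [Fintype W] (e : V ≃ W) (T : PointedTree V) :
    (T.map e).height = T.height := by
  unfold height
  rw [← e.sum_comp]
  refine Finset.sum_congr rfl fun v _ => ?_
  have := T.isTree.connected.dist_iso (Iso.comap e.symm T.graph).symm T.root v
  simpa [map] using this

/-- The relabelling bijection between rooted trees on equipotent vertex types. -/
def mapEquiv (e : V ≃ W) : PointedTree V ≃ PointedTree W where
  toFun := map e
  invFun := map e.symm
  left_inv := map_symm_map e
  right_inv := map_map_symm e

section Glue

variable {A B : Type*}

/-- Hang the tree `T₁` below the root of `T₂`: the two roots are joined by an edge, and the root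
of `T₂` is the new root. -/
def glue [Finite A] [Finite B] (T₁ : PointedTree A) (T₂ : PointedTree B) : PointedTree (A ⊕ B) where
  graph := (T₁.graph ⊕g T₂.graph) ⊔ edge (.inl T₁.root) (.inr T₂.root)
  root := .inr T₂.root
  isTree := by
    -- connected, and the number of edges is one less than the number of vertices
    refine isTree_iff_connected_and_card.2
      ⟨T₁.isTree.connected.sum_sup_edge T₂.isTree.connected, ?_⟩
    have h1 := (isTree_iff_connected_and_card.1 T₁.isTree).2
    have h2 := (isTree_iff_connected_and_card.1 T₂.isTree).2
    have h3 : s(.inl T₁.root, .inr T₂.root) ∉ (T₁.graph ⊕g T₂.graph).edgeSet := by simp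
    rw [edgeSet_sup, edgeSet_edge_of_ne (by simp), Set.union_singleton, Nat.card_coe_set_eq,
      Set.ncard_insert_of_notMem h3, ← Nat.card_coe_set_eq, Nat.card_congr edgeSetSumEquiv,
      Nat.card_sum, Nat.card_sum, ← h1, ← h2]
    lia

variable [Finite A] [Finite B]

@[simp]
theorem glue_adj_inl_inl (T₁ : PointedTree A) (T₂ : PointedTree B) (a a' : A) :
    (glue T₁ T₂).graph.Adj (.inl a) (.inl a') ↔ T₁.graph.Adj a a' := by
  simp [glue, edge_adj]

@[simp]
theorem glue_adj_inr_inr (T₁ : PointedTree A) (T₂ : PointedTree B) (b b' : B) :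
    (glue T₁ T₂).graph.Adj (.inr b) (.inr b') ↔ T₂.graph.Adj b b' := by
  simp [glue, edge_adj]

@[simp]
theorem glue_adj_inl_inr (T₁ : PointedTree A) (T₂ : PointedTree B) (a : A) (b : B) :
    (glue T₁ T₂).graph.Adj (.inl a) (.inr b) ↔ a = T₁.root ∧ b = T₂.root := by
  simp [glue, edge_adj]

@[simp]
theorem glue_adj_inr_inl (T₁ : PointedTree A) (T₂ : PointedTree B) (a : A) (b : B) :
    (glue T₁ T₂).graph.Adj (.inr b) (.inl a) ↔ a = T₁.root ∧ b = T₂.root := by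
  rw [SimpleGraph.adj_comm, glue_adj_inl_inr]

@[simp]
theorem glue_root (T₁ : PointedTree A) (T₂ : PointedTree B) :
    (glue T₁ T₂).root = .inr T₂.root := rfl

theorem glue_injective :
    Function.Injective fun p : PointedTree A × PointedTree B => glue p.1 p.2 := by
  rintro ⟨T₁, T₂⟩ ⟨T₁', T₂'⟩ h
  simp only at h
  have hr : T₂.root = T₂'.root := by simpa using congrArg root h
  have h1 (a a' : A) := (glue_adj_inl_inl T₁ T₂ a a').symm.trans (h ▸ glue_adj_inl_inl T₁' T₂' a a')
  have h2 (b b' : B) := (glue_adj_inr_inr T₁ T₂ b b').symm.trans (h ▸ glue_adj_inr_inr T₁' T₂' b b')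
  have h3 := (glue_adj_inl_inr T₁ T₂ T₁.root T₂.root).symm.trans
    (h ▸ glue_adj_inl_inr T₁' T₂' T₁.root T₂.root)
  refine Prod.ext (PointedTree.ext ?_ ?_) (PointedTree.ext ?_ hr)
  · ext a a'; exact h1 a a'
  · simpa [hr] using h3
  · ext b b'; exact h2 b b'

theorem dist_glue_inr (T₁ : PointedTree A) (T₂ : PointedTree B) (b : B) :
    (glue T₁ T₂).graph.dist (.inr T₂.root) (.inr b) = T₂.graph.dist T₂.root b := by
  have hc := (glue T₁ T₂).isTree.connected
  refine le_antisymm (T₂.isTree.connected.dist_map_le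
    (⟨Sum.inr, fun h => (glue_adj_inr_inr T₁ T₂ _ _).2 h⟩ : T₂.graph →g (glue T₁ T₂).graph) _ _) ?_
  -- the lower bound: the distance in `T₂`, extended by `0` to `A`, grows slowly along edges
  have := hc.le_add_dist_of_adj (f := Sum.elim (fun _ => 0) (T₂.graph.dist T₂.root)) (by
    rintro (a | b) (a' | b') h
    · simp
    · rw [glue_adj_inl_inr] at h
      simp [h.2]
    · simp
    · exact T₂.isTree.connected.dist_le_dist_add_one _ (by simpa using h)) (.inr T₂.root) (.inr b)
  simpa using this

theorem dist_glue_inl (T₁ : PointedTree A) (T₂ : PointedTree B) (a : A) :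
    (glue T₁ T₂).graph.dist (.inr T₂.root) (.inl a) = T₁.graph.dist T₁.root a + 1 := by
  have hc := (glue T₁ T₂).isTree.connected
  apply le_antisymm
  · have h1 := T₁.isTree.connected.dist_map_le
      (⟨Sum.inl, fun h => (glue_adj_inl_inl T₁ T₂ _ _).2 h⟩ : T₁.graph →g (glue T₁ T₂).graph)
      T₁.root a
    have h2 := hc.dist_triangle (u := .inr T₂.root) (v := .inl T₁.root) (w := .inl a)
    have h3 : (glue T₁ T₂).graph.dist (.inr T₂.root) (.inl T₁.root) = 1 :=
      dist_eq_one_iff_adj.2 (by simp)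
    simp only [RelHom.coeFn_mk] at h1
    lia
  · have := hc.le_add_dist_of_adj
      (f := Sum.elim (fun a => T₁.graph.dist T₁.root a + 1) (fun _ => 0)) (by
      rintro (a | b) (a' | b') h
      · simpa using T₁.isTree.connected.dist_le_dist_add_one _ (by simpa using h)
      · simp
      · rw [glue_adj_inr_inl] at h
        simp [h.1]
      · simp) (.inr T₂.root) (.inl a)
    simpa using this

theorem height_glue {A B : Type*} [Fintype A] [Fintype B] (T₁ : PointedTree A)
    (T₂ : PointedTree B) :
    (glue T₁ T₂).height = T₁.height + Fintype.card A + T₂.height := by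
  simp [height, Fintype.sum_sum_type, dist_glue_inr, dist_glue_inl, Finset.sum_add_distrib]

/-- A tree on `A ⊕ B` with its root in `B` arises by gluing if `A` spans a connected subgraph
that is joined to `B` at the root only. -/
theorem exists_glue_eq (T : PointedTree (A ⊕ B)) (b₀ : B) (hroot : T.root = .inr b₀)
    (hA : (T.graph.comap (Sum.inl : A → A ⊕ B)).Connected)
    (hAB : ∀ a b, T.graph.Adj (.inl a) (.inr b) → b = b₀) :
    ∃ (T₁ : PointedTree A) (T₂ : PointedTree B), glue T₁ T₂ = T := by
  obtain ⟨a₀, ha₀⟩ : ∃ a, T.graph.Adj (.inl a) (.inr b₀) := by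
    by_contra! h
    obtain ⟨a⟩ := hA.nonempty
    have := (T.isTree.connected (.inl a) (.inr b₀)).mem_of_adj (S := Set.range Sum.inl) (by
      rintro (a | b) (a' | b') h' hx
      · simp
      · exact absurd (hAB _ _ h' ▸ h') (h a)
      · simp
      · simp at hx) (by simp)
    simp at this
  have hB : (T.graph.comap (Sum.inr : B → A ⊕ B)).Connected := by
    -- collapsing `A` to the root maps walks of the tree to walks inside `B`
    refine (connected_iff_exists_forall_reachable _).2 ⟨b₀, fun b => ?_⟩
    refine reachable_map_of_adj (Sum.elim (fun _ => b₀) id) ?_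
      (T.isTree.connected (.inr b₀) (.inr b))
    rintro (a | b) (a' | b') h'
    · rfl
    · simp [hAB _ _ h']
    · simp [hAB _ _ h'.symm]
    · exact Adj.reachable (by simpa using h')
  let T₁ : PointedTree A := ⟨_, a₀, hA,
    T.isTree.isAcyclic.comap (Hom.comap Sum.inl T.graph) Sum.inl_injective⟩
  let T₂ : PointedTree B := ⟨_, b₀, hB,
    T.isTree.isAcyclic.comap (Hom.comap Sum.inr T.graph) Sum.inr_injective⟩
  refine ⟨T₁, T₂, PointedTree.ext ?_ hroot.symm⟩
  -- a tree has no proper connected spanning subgraph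
  have hle : (glue T₁ T₂).graph ≤ T.graph := by
    rintro (a | b) (a' | b') h
    · simpa [T₁] using h
    · obtain ⟨rfl, rfl⟩ := (glue_adj_inl_inr ..).1 h
      exact ha₀
    · obtain ⟨rfl, rfl⟩ := (glue_adj_inr_inl ..).1 h
      exact ha₀.symm
    · simpa [T₂] using h
  exact le_antisymm hle
    ((isTree_iff_minimal_connected.1 T.isTree).2 (glue T₁ T₂).isTree.connected hle)

end Glue

end PointedTree

/-! ### Branches at the root -/

namespace PointedTree

open SimpleGraph

variable {V W : Type*}

section Branch

/-- `S` is a branch of `T`: the vertex set of one of the connected components that remain when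
the root is deleted. -/
structure IsBranch (T : PointedTree V) (S : Finset V) : Prop where
  root_notMem : T.root ∉ S
  connected : (T.graph.induce (S : Set V)).Connected
  eq_root_of_adj : ∀ u ∈ S, ∀ w ∉ S, T.graph.Adj u w → w = T.root

theorem IsBranch.subset {T : PointedTree V} {S S' : Finset V} (h : T.IsBranch S)
    (h' : T.IsBranch S') {v : V} (hv : v ∈ S) (hv' : v ∈ S') : S ⊆ S' := fun u hu =>
  (h.connected ⟨v, hv⟩ ⟨u, hu⟩).mem_of_adj (S := {x : (S : Set V) | (x : V) ∈ S'}) (by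
    rintro ⟨x, hx⟩ ⟨y, hy⟩ hxy hx'
    by_contra hy'
    exact h.root_notMem (h'.eq_root_of_adj x hx' y hy' hxy ▸ hy)) hv'

theorem exists_isBranch [Finite V] (T : PointedTree V) {v : V} (hv : v ≠ T.root) :
    ∃ S : Finset V, T.IsBranch S ∧ v ∈ S := by
  classical
  have := Fintype.ofFinite V
  let G := T.graph.deleteIncidenceSet T.root
  have hmem (u : V) : u ∈ (G.connectedComponentMk v).supp.toFinset ↔ G.Reachable u v := by
    simp [ConnectedComponent.mem_supp_iff]
  have hroot : ¬ G.Reachable T.root v := fun h =>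
    hv (h.mem_of_adj (S := {T.root}) (by
      intro x y hxy hx
      exact absurd hx (deleteIncidenceSet_adj.1 hxy).2.1) rfl)
  refine ⟨(G.connectedComponentMk v).supp.toFinset, ⟨(hmem _).not.2 hroot, ?_, ?_⟩,
    (hmem v).2 .rfl⟩
  · rw [Set.coe_toFinset]
    exact (G.connectedComponentMk v).connected_toSimpleGraph.mono
      (comap_monotone _ (deleteIncidenceSet_le _ _))
  · intro u hu w hw huw
    rw [hmem] at hu hw
    by_contra hne
    refine hw (Reachable.trans (Adj.reachable ?_) hu)
    exact deleteIncidenceSet_adj.2 ⟨huw.symm, hne, fun h => hroot (h ▸ hu)⟩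

open Classical in
/-- Every vertex other than the root lies in exactly one branch. -/
theorem sum_card_isBranch [Fintype V] (T : PointedTree V) :
    ∑ S : Finset V with T.IsBranch S, S.card = Fintype.card V - 1 := by
  have h1 : (Finset.univ.filter T.IsBranch).biUnion id = Finset.univ.erase T.root := by
    ext v
    simp only [Finset.mem_biUnion, Finset.mem_filter_univ, id, Finset.mem_erase,
      Finset.mem_univ, and_true]
    exact ⟨fun ⟨S, hS, hv⟩ h => hS.root_notMem (h ▸ hv), fun h => T.exists_isBranch h⟩
  rw [← Finset.card_univ, ← Finset.card_erase_of_mem (Finset.mem_univ T.root), ← h1,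
    Finset.card_biUnion]
  · rfl
  · intro S hS S' hS' hne
    rw [Finset.mem_coe, Finset.mem_filter_univ] at hS hS'
    refine Finset.disjoint_left.2 fun v hv hv' => hne ?_
    exact (hS.subset hS' hv hv').antisymm (hS'.subset hS hv' hv)

variable [Fintype V] {M : Type*} [AddCommMonoid M]

/-- The sum of `g (height T)` over all rooted trees `T` on `V`. -/
noncomputable def heightSum (V : Type*) [Fintype V] (g : ℕ → M) : M :=
  ∑ T : PointedTree V, g T.height

theorem heightSum_congr [Fintype W] (e : V ≃ W) (g : ℕ → M) :
    heightSum V g = heightSum W g :=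
  Fintype.sum_equiv (mapEquiv e) _ _ fun T => by rw [mapEquiv, Equiv.coe_fn_mk, height_map]

theorem heightSum_eq_fin (g : ℕ → M) : heightSum V g = heightSum (Fin (Fintype.card V)) g :=
  heightSum_congr (Fintype.equivFin V) g

theorem isBranch_map_glue [DecidableEq V] (S : Finset V) (T₁ : PointedTree {v // v ∈ S})
    (T₂ : PointedTree {v // v ∉ S}) :
    ((glue T₁ T₂).map (Equiv.sumCompl (· ∈ S))).IsBranch S where
  root_notMem := T₂.root.2
  connected := by
    refine T₁.isTree.connected.mono fun a a' h => ?_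
    simpa [map, Equiv.sumCompl_symm_apply_of_pos] using h
  eq_root_of_adj u hu w hw h := by
    simp only [map, comap_adj, Equiv.sumCompl_symm_apply_of_pos hu,
      Equiv.sumCompl_symm_apply_of_neg hw, glue_adj_inl_inr] at h
    simp [map, ← h.2]

theorem IsBranch.exists_eq_map_glue [DecidableEq V] {T : PointedTree V} {S : Finset V}
    (h : T.IsBranch S) : ∃ (T₁ : PointedTree {v // v ∈ S}) (T₂ : PointedTree {v // v ∉ S}),
      (glue T₁ T₂).map (Equiv.sumCompl (· ∈ S)) = T := by
  obtain ⟨T₁, T₂, hT⟩ := exists_glue_eq (T.map (Equiv.sumCompl (· ∈ S)).symm)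
    ⟨T.root, h.root_notMem⟩ (Equiv.sumCompl_symm_apply_of_neg h.root_notMem)
    (h.connected.mono fun a a' haa' => by simpa [map] using haa')
    (fun a b hab => Subtype.ext (h.eq_root_of_adj a a.2 b b.2 (by simpa [map] using hab)))
  exact ⟨T₁, T₂, by rw [hT, map_map_symm]⟩

open Classical in
/-- Cutting off the branch `S`: the rooted trees with branch `S` correspond to pairs of a rooted
tree on `S` and one on the complement. -/
theorem sum_isBranch [DecidableEq V] (S : Finset V) (g : ℕ → M) :
    ∑ T : PointedTree V with T.IsBranch S, g T.height =
      heightSum {v // v ∈ S} fun h₁ => heightSum {v // v ∉ S} fun h₂ => g (h₁ + S.card + h₂) := by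
  unfold heightSum
  rw [← Fintype.sum_prod_type']
  symm
  refine Finset.sum_bij (fun p _ => (glue p.1 p.2).map (Equiv.sumCompl (· ∈ S))) ?_ ?_ ?_ ?_
  · intro p _
    exact Finset.mem_filter_univ _ |>.2 (isBranch_map_glue S p.1 p.2)
  · intro p _ q _ h
    exact glue_injective ((mapEquiv (Equiv.sumCompl (· ∈ S))).injective h)
  · intro T hT
    obtain ⟨T₁, T₂, h⟩ := ((Finset.mem_filter_univ _).1 hT).exists_eq_map_glue
    exact ⟨(T₁, T₂), Finset.mem_univ _, h⟩
  · intro p _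
    rw [height_map, height_glue, Fintype.card_coe]

/-- The branch recurrence: counting pairs of a rooted tree on `n` vertices and a vertex other than
the root, by the branch that contains the vertex. -/
theorem branch_recurrence (n : ℕ) (g : ℕ → M) :
    (n - 1) • heightSum (Fin n) g = ∑ k ∈ Finset.range (n + 1), n.choose k • k •
      heightSum (Fin k) fun h₁ => heightSum (Fin (n - k)) fun h₂ => g (h₁ + k + h₂) := by
  classical
  have h1 : (n - 1) • heightSum (Fin n) g =
      ∑ S : Finset (Fin n), S.card • ∑ T : PointedTree (Fin n) with T.IsBranch S, g T.height := by
    simp_rw [heightSum, Finset.smul_sum, Finset.sum_filter]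
    rw [Finset.sum_comm]
    refine Finset.sum_congr rfl fun T _ => ?_
    rw [← Finset.sum_filter, ← Finset.sum_smul, sum_card_isBranch, Fintype.card_fin]
  let F (k : ℕ) : M :=
    k • heightSum (Fin k) fun h₁ => heightSum (Fin (n - k)) fun h₂ => g (h₁ + k + h₂)
  have h2 (S : Finset (Fin n)) :
      S.card • ∑ T : PointedTree (Fin n) with T.IsBranch S, g T.height =
      F S.card := by
    rw [sum_isBranch, heightSum_eq_fin, Fintype.card_coe]
    congr! 3 with h₁
    rw [heightSum_eq_fin]
    rw [Fintype.card_subtype_compl, Fintype.card_coe, Fintype.card_fin]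
  rw [h1, Finset.sum_congr rfl fun S _ => h2 S, ← Finset.powerset_univ,
    Finset.sum_powerset_apply_card F, Finset.card_univ, Fintype.card_fin]

end Branch

end PointedTree

/-! ### The equations for the moment generating functions -/

namespace PowerSeries

/-- The derivation `θ = X d/dX` of the ring of power series. -/
noncomputable def theta : Derivation ℝ ℝ⟦X⟧ ℝ⟦X⟧ := (X : ℝ⟦X⟧) • derivative ℝ

theorem theta_apply (f : ℝ⟦X⟧) : theta f = X * derivative ℝ f := rfl

@[simp]
theorem coeff_theta (f : ℝ⟦X⟧) (n : ℕ) : coeff n (theta f) = n * coeff n f := by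
  rw [theta_apply]
  cases n with
  | zero => simp
  | succ n => rw [coeff_succ_X_mul, coeff_derivative]; push_cast; ring

@[simp]
theorem coeff_iterate_theta (f : ℝ⟦X⟧) (k n : ℕ) :
    coeff n (theta^[k] f) = n ^ k * coeff n f := by
  induction k with
  | zero => simp
  | succ k ih => rw [Function.iterate_succ_apply', coeff_theta, ih]; ring

/-- The homogeneous linear equation satisfied by the difference of two solutions of the moment
equations determines all coefficients from the first two: the `n`-th coefficient of the left side
is `n - 1` times that of `E`, and the right side involves only earlier coefficients of `E`. -/
theorem eq_zero_of_theta_sub_self {E A B : ℝ⟦X⟧} (h0 : coeff 0 E = 0) (h1 : coeff 1 E = 0)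
    (hA : coeff 0 A = 0) (hB : coeff 0 B = 0) (h : theta E - E = theta E * A + B * E) : E = 0 := by
  ext n
  induction n using Nat.strong_induction_on with
  | _ n ih =>
    rcases lt_or_ge n 2 with hn | hn
    · interval_cases n
      · exact h0
      · exact h1
    have hc := congrArg (coeff n) h
    rw [map_sub, map_add, coeff_mul, coeff_mul, Finset.sum_eq_zero, Finset.sum_eq_zero,
      coeff_theta] at hc
    · have hn' : (2 : ℝ) ≤ n := by exact_mod_cast hn
      have : ((n : ℝ) - 1) * coeff n E = 0 := by linear_combination hc
      simpa [show (n : ℝ) - 1 ≠ 0 by linarith] using this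
    · rintro ⟨i, j⟩ hij
      rw [Finset.HasAntidiagonal.mem_antidiagonal] at hij
      rcases Nat.eq_zero_or_pos i with rfl | hi
      · simp [hB]
      · simp [ih j (by simp only at hij; lia)]
    · rintro ⟨i, j⟩ hij
      rw [Finset.HasAntidiagonal.mem_antidiagonal] at hij
      rcases Nat.eq_zero_or_pos j with rfl | hj
      · simp [hA]
      · simp [ih i (by simp only at hij; lia)]

/-- The system of equations for the exponential generating functions `F j` of the `j`-th moments
of the total height: it is the branch recurrence, the sum over `i` being the generating function
of the moments of the height increased by the number of vertices. -/
structure IsMomentSystem (F : ℕ → ℝ⟦X⟧) (N : ℕ) : Prop where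
  coeff_zero : ∀ j ≤ N, coeff 0 (F j) = 0
  coeff_one : ∀ j ≤ N, coeff 1 (F j) = if j = 0 then 1 else 0
  eqn : ∀ j ≤ N, theta (F j) - F j = ∑ a ∈ Finset.range (j + 1),
    (j.choose a : ℝ⟦X⟧) * theta (∑ i ∈ Finset.range (a + 1),
      (a.choose i : ℝ⟦X⟧) * theta^[a - i] (F i)) * F (j - a)

theorem IsMomentSystem.unique {F F' : ℕ → ℝ⟦X⟧} {N : ℕ} (h : IsMomentSystem F N)
    (h' : IsMomentSystem F' N) (j : ℕ) (hj : j ≤ N) : F j = F' j := by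
  induction j using Nat.strong_induction_on with
  | _ j ih =>
    have hE := h.eqn j hj
    have hE' := h'.eqn j hj
    have h0 : coeff 0 (F j - F' j) = 0 := by
      rw [map_sub, h.coeff_zero j hj, h'.coeff_zero j hj, sub_self]
    have h1 : coeff 1 (F j - F' j) = 0 := by
      rw [map_sub, h.coeff_one j hj, h'.coeff_one j hj, sub_self]
    rw [← sub_eq_zero]
    refine eq_zero_of_theta_sub_self h0 h1 (A := F 0) (B := theta (F' 0))
      (h.coeff_zero 0 (Nat.zero_le _)) (by simp) ?_
    cases j with
    | zero =>
      simp only [zero_add, Finset.range_one, Finset.sum_singleton, Nat.choose_self, Nat.cast_one,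
        one_mul, Nat.sub_self, Function.iterate_zero, id] at hE hE'
      rw [map_sub]
      linear_combination hE - hE'
    | succ m =>
      have ih0 : F 0 = F' 0 := ih 0 (by lia) (by lia)
      -- the terms `a = 0` and `a = j` contain the unknown `F j`, the others agree by induction
      have hmid : ∑ a ∈ Finset.range m, ((m + 1).choose (a + 1) : ℝ⟦X⟧) *
            theta (∑ i ∈ Finset.range (a + 1 + 1),
              ((a + 1).choose i : ℝ⟦X⟧) * theta^[a + 1 - i] (F i)) * F (m + 1 - (a + 1)) =
          ∑ a ∈ Finset.range m, ((m + 1).choose (a + 1) : ℝ⟦X⟧) *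
            theta (∑ i ∈ Finset.range (a + 1 + 1),
              ((a + 1).choose i : ℝ⟦X⟧) * theta^[a + 1 - i] (F' i)) * F' (m + 1 - (a + 1)) := by
        refine Finset.sum_congr rfl fun a ha => ?_
        rw [Finset.mem_range] at ha
        rw [ih _ (by lia) (by lia)]
        congr 3
        refine Finset.sum_congr rfl fun i hi => ?_
        rw [Finset.mem_range] at hi
        rw [ih i (by lia) (by lia)]
      have hlow : ∑ i ∈ Finset.range (m + 1), ((m + 1).choose i : ℝ⟦X⟧) *
            theta^[m + 1 - i] (F i) =
          ∑ i ∈ Finset.range (m + 1), ((m + 1).choose i : ℝ⟦X⟧) * theta^[m + 1 - i] (F' i) := by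
        refine Finset.sum_congr rfl fun i hi => ?_
        rw [Finset.mem_range] at hi
        rw [ih i (by lia) (by lia)]
      rw [Finset.sum_range_succ, Finset.sum_range_succ', hmid,
        Finset.sum_range_succ _ (m + 1), hlow] at hE
      rw [Finset.sum_range_succ, Finset.sum_range_succ', Finset.sum_range_succ _ (m + 1)] at hE'
      simp only [zero_add, Finset.range_one, Finset.sum_singleton, Nat.choose_self, Nat.cast_one,
        one_mul, Nat.sub_self, Function.iterate_zero, id, Nat.choose_zero_right, Nat.sub_zero,
        map_add, ih0] at hE hE'
      rw [map_sub, ih0]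
      linear_combination hE - hE'

end PowerSeries

namespace PointedTree

open PowerSeries

/-- The sum of the `j`-th powers of the total heights of the rooted trees on `n` labels. -/
noncomputable def powerSum (j n : ℕ) : ℝ := heightSum (Fin n) fun h => (h : ℝ) ^ j

/-- The exponential generating function of `powerSum j`. -/
noncomputable def momentSeries (j : ℕ) : ℝ⟦X⟧ :=
  PowerSeries.mk fun n => powerSum j n / n !

theorem powerSum_zero_right (j : ℕ) : powerSum j 0 = 0 := by
  have : IsEmpty (PointedTree (Fin 0)) := ⟨fun T => T.root.elim0⟩
  simp [powerSum, heightSum]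

theorem powerSum_one_right (j : ℕ) : powerSum j 1 = if j = 0 then 1 else 0 := by
  have hu : ∀ T : PointedTree (Fin 1), T = ⟨⊥, 0, .of_subsingleton⟩ := fun T =>
    PointedTree.ext (Subsingleton.elim _ _) (Subsingleton.elim _ _)
  have : Unique (PointedTree (Fin 1)) := ⟨⟨⟨⊥, 0, .of_subsingleton⟩⟩, hu⟩
  rw [powerSum, heightSum, Fintype.sum_unique, hu default]
  simp [height, zero_pow_eq]

/-- The moments of the height increased by the number `k` of vertices. -/
theorem heightSum_add_pow (a k : ℕ) :
    (heightSum (Fin k) fun h => ((h : ℝ) + k) ^ a) =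
      ∑ i ∈ Finset.range (a + 1), (a.choose i : ℝ) * (k ^ (a - i) * powerSum i k) := by
  simp_rw [powerSum, heightSum, add_pow, Finset.mul_sum]
  rw [Finset.sum_comm]
  exact Finset.sum_congr rfl fun i _ => Finset.sum_congr rfl fun T _ => by ring

/-- The branch recurrence for `g h = h ^ j`: by the binomial theorem, the sum over the pairs of
trees factors. At `n = 0` both sides vanish, so no hypothesis on `n` is needed. -/
theorem powerSum_recurrence (j n : ℕ) :
    ((n : ℝ) - 1) * powerSum j n = ∑ k ∈ Finset.range (n + 1), (n.choose k : ℝ) *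
      ∑ a ∈ Finset.range (j + 1), (j.choose a : ℝ) *
        (k * heightSum (Fin k) fun h => ((h : ℝ) + k) ^ a) * powerSum (j - a) (n - k) := by
  have h := branch_recurrence n fun h => (h : ℝ) ^ j
  have hl : ((n : ℝ) - 1) * powerSum j n = (n - 1) • powerSum j n := by
    rcases Nat.eq_zero_or_pos n with rfl | hn
    · simp [powerSum_zero_right]
    · rw [nsmul_eq_mul, Nat.cast_sub hn, Nat.cast_one]
  rw [hl, powerSum, h]
  refine Finset.sum_congr rfl fun k _ => ?_
  rw [nsmul_eq_mul, nsmul_eq_mul]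
  congr 1
  have hsum : (heightSum (Fin k) fun h₁ => heightSum (Fin (n - k)) fun h₂ =>
      (((h₁ + k + h₂ : ℕ) : ℝ) ^ j)) = ∑ a ∈ Finset.range (j + 1), (j.choose a : ℝ) *
        ((heightSum (Fin k) fun h => ((h : ℝ) + k) ^ a) * powerSum (j - a) (n - k)) := by
    simp_rw [powerSum, heightSum, Finset.sum_mul_sum, Finset.mul_sum]
    refine Eq.symm (Finset.sum_comm.trans (Finset.sum_congr rfl fun T _ => ?_))
    refine Finset.sum_comm.trans (Finset.sum_congr rfl fun T' _ => ?_)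
    push_cast
    rw [add_pow]
    exact Finset.sum_congr rfl fun a _ => by ring
  rw [hsum, Finset.mul_sum]
  exact Finset.sum_congr rfl fun a _ => by ring

theorem isMomentSystem_momentSeries (N : ℕ) : IsMomentSystem momentSeries N where
  coeff_zero j _ := by rw [momentSeries, coeff_mk, powerSum_zero_right, zero_div]
  coeff_one j _ := by simp [momentSeries, powerSum_one_right]
  eqn j _ := by
    ext n
    have hn : (n ! : ℝ) ≠ 0 := by exact_mod_cast n.factorial_ne_zero
    have h := powerSum_recurrence j n
    have hs (a k : ℕ) : coeff k (theta (∑ i ∈ Finset.range (a + 1),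
        (a.choose i : ℝ⟦X⟧) * theta^[a - i] (momentSeries i))) =
        (k * heightSum (Fin k) fun h => ((h : ℝ) + k) ^ a) / k ! := by
      rw [coeff_theta, heightSum_add_pow, map_sum, mul_div_assoc, Finset.sum_div]
      congr 1
      refine Finset.sum_congr rfl fun i _ => ?_
      rw [← map_natCast (C (R := ℝ)), coeff_C_mul, coeff_iterate_theta, momentSeries, coeff_mk]
      ring
    rw [map_sub, coeff_theta, momentSeries, coeff_mk, map_sum]
    simp_rw [mul_assoc, ← map_natCast (C (R := ℝ)), coeff_C_mul, coeff_mul,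
      Finset.Nat.sum_antidiagonal_eq_sum_range_succ_mk]
    simp_rw [map_natCast, hs]
    rw [← sub_one_mul, ← mul_div_assoc, h, Finset.sum_div]
    simp_rw [Finset.mul_sum]
    rw [Finset.sum_comm]
    refine Finset.sum_congr rfl fun k hk => ?_
    rw [Finset.sum_div]
    refine Finset.sum_congr rfl fun a _ => ?_
    have hk' : k ≤ n := by simpa [Nat.lt_succ_iff] using hk
    rw [momentSeries, coeff_mk, Nat.cast_choose ℝ hk']
    field_simp

end PointedTree

/-! ### Lagrange inversion for the tree function -/

namespace PowerSeries

/-- The power series `e ^ (a X)`. -/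
noncomputable def expMul (a : ℝ) : ℝ⟦X⟧ := rescale a (exp ℝ)

@[simp]
theorem coeff_expMul (a : ℝ) (n : ℕ) : coeff n (expMul a) = a ^ n / n ! := by
  simp [expMul, coeff_rescale, coeff_exp, div_eq_mul_inv]

theorem expMul_zero : expMul 0 = 1 := by
  simp [expMul]

theorem expMul_mul (a b : ℝ) : expMul a * expMul b = expMul (a + b) :=
  exp_mul_exp_eq_exp_add a b

theorem expMul_pow (a : ℝ) (m : ℕ) : expMul a ^ m = expMul (m * a) := by
  induction m with
  | zero => simp [expMul_zero]
  | succ m ih => rw [pow_succ, ih, expMul_mul]; push_cast; ring_nf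

theorem derivative_expMul (a : ℝ) : derivative ℝ (expMul a) = C a * expMul a := by
  ext n
  rw [coeff_derivative, coeff_C_mul, coeff_expMul, coeff_expMul, Nat.factorial_succ]
  have : (n ! : ℝ) ≠ 0 := by exact_mod_cast n.factorial_ne_zero
  push_cast
  field_simp
  ring

/-- Lagrange inversion: `lagrange g = g(T)`, where `T = X e ^ T` is the tree function, is defined
by the formula `[X ^ n] g(T) = [w ^ n] g(w) (1 - w) e ^ (n w)`. -/
noncomputable def lagrange (g : ℝ⟦X⟧) : ℝ⟦X⟧ :=
  PowerSeries.mk fun n => coeff n (g * (1 - X) * expMul n)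

theorem coeff_lagrange (g : ℝ⟦X⟧) (n : ℕ) :
    coeff n (lagrange g) = coeff n (g * (1 - X) * expMul n) := coeff_mk _ _

theorem lagrange_add (g h : ℝ⟦X⟧) : lagrange (g + h) = lagrange g + lagrange h := by
  ext n
  simp only [coeff_lagrange, map_add, add_mul]

theorem lagrange_C_mul (c : ℝ) (g : ℝ⟦X⟧) : lagrange (C c * g) = C c * lagrange g := by
  ext n
  rw [coeff_C_mul, coeff_lagrange, coeff_lagrange, mul_assoc, mul_assoc, coeff_C_mul, mul_assoc]

theorem X_pow_dvd_lagrange {N : ℕ} {g : ℝ⟦X⟧} (h : X ^ N ∣ g) : X ^ N ∣ lagrange g := by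
  rw [X_pow_dvd_iff]
  intro m hm
  rw [coeff_lagrange]
  exact X_pow_dvd_iff.1 (dvd_mul_of_dvd_left (dvd_mul_of_dvd_left h _) _) m hm

/-- The compositional inverse `w e ^ (-w)` of the tree function. -/
noncomputable def treeInv : ℝ⟦X⟧ := X * expMul (-1)

/-- `lagrange` inverts substitution of `w e ^ (-w)`: for `k = n - m > 0` the coefficient of
`w ^ k` in `(1 - w) e ^ (k w)` vanishes. -/
theorem lagrange_treeInv_pow (m : ℕ) : lagrange (treeInv ^ m) = X ^ m := by
  ext n
  rw [coeff_lagrange, treeInv, mul_pow, expMul_pow, mul_assoc, mul_assoc, coeff_X_pow_mul',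
    coeff_X_pow]
  split_ifs with h1 h2 h2
  · subst h2
    rw [mul_comm (1 - X), ← mul_assoc, expMul_mul]
    simp [expMul_zero]
  · obtain ⟨k, rfl⟩ := Nat.exists_eq_add_of_le h1
    have hk : k ≠ 0 := by lia
    obtain ⟨k, rfl⟩ := Nat.exists_eq_add_one_of_ne_zero hk
    rw [mul_left_comm, expMul_mul, Nat.add_sub_cancel_left, sub_mul, one_mul, map_sub,
      coeff_succ_X_mul, coeff_expMul, coeff_expMul, Nat.factorial_succ,
      show (m : ℝ) * -1 + ((m + (k + 1) : ℕ) : ℝ) = k + 1 by push_cast; ring]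
    have : (k ! : ℝ) ≠ 0 := by exact_mod_cast k.factorial_ne_zero
    push_cast
    field_simp
    ring
  · lia
  · rfl

theorem lagrange_aeval_treeInv (p : Polynomial ℝ) :
    lagrange (Polynomial.aeval treeInv p) = p := by
  induction p using Polynomial.induction_on' with
  | add p q hp hq => rw [map_add, lagrange_add, hp, hq, Polynomial.coe_add]
  | monomial n a =>
    rw [Polynomial.aeval_monomial, Polynomial.coe_monomial, algebraMap_apply,
      Algebra.algebraMap_self, RingHom.id_apply, lagrange_C_mul, lagrange_treeInv_pow,
      ← monomial_zero_eq_C_apply, X_pow_eq, monomial_mul_monomial]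
    simp

/-- Polynomials in `w e ^ (-w)` are dense in the `w`-adic topology. -/
theorem exists_X_pow_dvd_sub_aeval (g : ℝ⟦X⟧) (N : ℕ) :
    ∃ p : Polynomial ℝ, X ^ N ∣ g - Polynomial.aeval treeInv p := by
  induction N with
  | zero => exact ⟨0, by simp⟩
  | succ N ih =>
    obtain ⟨p, r, hr⟩ := ih
    refine ⟨p + Polynomial.monomial N (coeff 0 r), ?_⟩
    have h : X ∣ r - C (coeff 0 r) * expMul (-1) ^ N := by
      rw [X_dvd_iff, expMul_pow, ← coeff_zero_eq_constantCoeff_apply, map_sub, coeff_C_mul]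
      simp
    rw [map_add, Polynomial.aeval_monomial, ← sub_sub, hr, algebraMap_apply, treeInv, mul_pow,
      Algebra.algebraMap_self, RingHom.id_apply, pow_succ,
      show X ^ N * r - C (coeff 0 r) * (X ^ N * expMul (-1) ^ N) =
        X ^ N * (r - C (coeff 0 r) * expMul (-1) ^ N) by ring]
    exact mul_dvd_mul_left _ h

/-- On polynomials in `w e ^ (-w)`, multiplicativity is clear; these are dense, and `lagrange` is
continuous in the adic topology. -/
theorem lagrange_mul (g h : ℝ⟦X⟧) : lagrange (g * h) = lagrange g * lagrange h := by
  rw [← sub_eq_zero]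
  ext N
  obtain ⟨p, hp⟩ := exists_X_pow_dvd_sub_aeval g (N + 1)
  obtain ⟨q, hq⟩ := exists_X_pow_dvd_sub_aeval h (N + 1)
  have hsub (a b : ℝ⟦X⟧) (hab : X ^ (N + 1) ∣ a - b) : X ^ (N + 1) ∣ lagrange a - lagrange b := by
    have := lagrange_add (a - b) b
    rw [sub_add_cancel] at this
    rw [this, add_sub_cancel_right]
    exact X_pow_dvd_lagrange hab
  have key (a b c d : ℝ⟦X⟧) (h1 : X ^ (N + 1) ∣ a - b) (h2 : X ^ (N + 1) ∣ c - d) :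
      X ^ (N + 1) ∣ a * c - b * d := by
    rw [show a * c - b * d = (a - b) * c + b * (c - d) by ring]
    exact dvd_add (dvd_mul_of_dvd_left h1 _) (dvd_mul_of_dvd_right h2 _)
  have h1 := hsub _ _ (key _ _ _ _ hp hq)
  have h2 := key _ _ _ _ (hsub _ _ hp) (hsub _ _ hq)
  rw [← map_mul, lagrange_aeval_treeInv, Polynomial.coe_mul] at h1
  rw [lagrange_aeval_treeInv, lagrange_aeval_treeInv] at h2
  have h3 := dvd_sub h1 h2
  rw [sub_sub_sub_cancel_right] at h3
  exact X_pow_dvd_iff.1 h3 N N.lt_succ_self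

/-- Lagrange inversion as a ring homomorphism: substitution of the tree function. -/
noncomputable def lagrangeHom : ℝ⟦X⟧ →+* ℝ⟦X⟧ where
  toFun := lagrange
  map_one' := by simpa using lagrange_treeInv_pow 0
  map_mul' := lagrange_mul
  map_zero' := by simpa using lagrange_C_mul 0 0
  map_add' := lagrange_add

theorem coeff_lagrangeHom (g : ℝ⟦X⟧) (n : ℕ) :
    coeff n (lagrangeHom g) = coeff n (g * (1 - X) * expMul n) := coeff_lagrange g n

/-- The geometric series `1 / (1 - X)`. -/
noncomputable def geom : ℝ⟦X⟧ := PowerSeries.mk 1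

theorem geom_mul_one_sub_X : geom * (1 - X) = 1 := mk_one_mul_one_sub_eq_one ℝ

theorem X_mul_geom : X * geom = geom - 1 := by
  linear_combination -geom_mul_one_sub_X

/-- The derivation `X / (1 - X) d/dX`, which corresponds to `θ` under substitution of the tree
function. -/
noncomputable def treeTheta : Derivation ℝ ℝ⟦X⟧ ℝ⟦X⟧ := (X * geom : ℝ⟦X⟧) • derivative ℝ

theorem treeTheta_apply (f : ℝ⟦X⟧) : treeTheta f = X * geom * derivative ℝ f := rfl

/-- From `T = x e ^ T` one gets `θ T = T / (1 - T)`, so `θ` acts on functions of `T` as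
`T / (1 - T) d/dT`. On coefficients this is `[w ^ n] θ h = n [w ^ n] h` for `h = g e ^ (n w)`. -/
theorem theta_lagrangeHom (g : ℝ⟦X⟧) : theta (lagrangeHom g) = lagrangeHom (treeTheta g) := by
  ext n
  have h := coeff_theta (g * expMul n) n
  rw [theta_apply, Derivation.leibniz, derivative_expMul, smul_eq_mul, smul_eq_mul,
    show X * (g * (C (n : ℝ) * expMul n) + expMul n * derivative ℝ g) =
      C (n : ℝ) * (X * g * expMul n) + X * derivative ℝ g * expMul n by ring, map_add,
    coeff_C_mul] at h
  rw [coeff_theta, coeff_lagrangeHom, coeff_lagrangeHom, treeTheta_apply,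
    show X * geom * derivative ℝ g * (1 - X) = (geom * (1 - X)) * (X * derivative ℝ g) by ring,
    geom_mul_one_sub_X, one_mul, show g * (1 - X) * expMul n = g * expMul n - X * g * expMul n by
      ring, map_sub]
  linear_combination -h

theorem theta_iterate_lagrangeHom (g : ℝ⟦X⟧) (k : ℕ) :
    theta^[k] (lagrangeHom g) = lagrangeHom (treeTheta^[k] g) := by
  induction k with
  | zero => rfl
  | succ k ih => rw [Function.iterate_succ_apply', ih, theta_lagrangeHom,
      Function.iterate_succ_apply']

theorem derivative_geom : derivative ℝ geom = geom ^ 2 := by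
  have h := congrArg (derivative ℝ) geom_mul_one_sub_X
  rw [Derivation.leibniz, map_sub, derivative_X, smul_eq_mul, smul_eq_mul,
    Derivation.map_one_eq_zero] at h
  linear_combination geom * h - (derivative ℝ geom) * geom_mul_one_sub_X

theorem treeTheta_geom : treeTheta geom = geom ^ 3 - geom ^ 2 := by
  rw [treeTheta_apply, derivative_geom, X_mul_geom]
  ring

theorem treeTheta_X : treeTheta X = geom - 1 := by
  rw [treeTheta_apply, derivative_X, X_mul_geom, mul_one]

theorem treeTheta_geom_pow (m : ℕ) :
    treeTheta (geom ^ m) = m * (geom ^ (m + 2) - geom ^ (m + 1)) := by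
  rw [Derivation.leibniz_pow, treeTheta_geom, nsmul_eq_mul, smul_eq_mul]
  cases m with
  | zero => simp
  | succ m => rw [Nat.add_sub_cancel]; ring

theorem coeff_lagrangeHom_geom (n : ℕ) : coeff n (lagrangeHom geom) = (n : ℝ) ^ n / n ! := by
  rw [coeff_lagrangeHom, geom_mul_one_sub_X, one_mul, coeff_expMul]

theorem coeff_lagrangeHom_geom_sq (n : ℕ) :
    coeff n (lagrangeHom (geom ^ 2)) = ∑ k ∈ Finset.range (n + 1), (n : ℝ) ^ k / k ! := by
  rw [coeff_lagrangeHom, sq, mul_assoc geom, geom_mul_one_sub_X, mul_one, mul_comm, coeff_mul,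
    Finset.Nat.sum_antidiagonal_eq_sum_range_succ_mk]
  simp [geom]

/-- The coefficients of `1 / (1 - T) ^ m` satisfy a recurrence of order two in `m`, read off from
the action of `θ`. -/
theorem coeff_lagrangeHom_geom_pow_add_two (m n : ℕ) (hm : m ≠ 0) :
    coeff n (lagrangeHom (geom ^ (m + 2))) =
      coeff n (lagrangeHom (geom ^ (m + 1))) + n / m * coeff n (lagrangeHom (geom ^ m)) := by
  have h := congrArg (coeff n) (theta_lagrangeHom (geom ^ m))
  rw [coeff_theta, treeTheta_geom_pow, map_mul, map_natCast, ← map_natCast (C (R := ℝ)),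
    coeff_C_mul, map_sub, map_sub] at h
  have hm' : (m : ℝ) ≠ 0 := by exact_mod_cast hm
  field_simp
  linear_combination -h

theorem coeff_lagrangeHom_X {n : ℕ} (hn : n ≠ 0) :
    n * coeff n (lagrangeHom X) = (n : ℝ) ^ n / n ! := by
  have h := congrArg (coeff n) (theta_lagrangeHom X)
  rw [coeff_theta, treeTheta_X, map_sub, map_sub, map_one, coeff_one, if_neg hn, sub_zero,
    coeff_lagrangeHom_geom] at h
  exact h

end PowerSeries

/-! ### Solution of the moment equations -/

namespace PowerSeries

theorem coeff_zero_lagrangeHom (g : ℝ⟦X⟧) : coeff 0 (lagrangeHom g) = coeff 0 g := by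
  simp [coeff_lagrangeHom, expMul_zero]

theorem coeff_one_lagrangeHom (g : ℝ⟦X⟧) : coeff 1 (lagrangeHom g) = coeff 1 g := by
  rw [coeff_lagrangeHom, mul_assoc, coeff_mul, Finset.Nat.sum_antidiagonal_eq_sum_range_succ_mk]
  have h : coeff 1 (X * expMul 1) = 1 := by
    rw [show 1 = 0 + 1 from rfl, coeff_succ_X_mul]
    simp
  simp [Finset.sum_range_succ, sub_mul, h, coeff_zero_X_mul, -coeff_zero_eq_constantCoeff]

theorem coeff_one_geom_pow (m : ℕ) : coeff 1 (geom ^ m) = m := by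
  rw [coeff_one_pow]
  simp [geom]

@[simp]
theorem constantCoeff_geom : constantCoeff geom = 1 := by
  simp [geom, ← coeff_zero_eq_constantCoeff_apply]

theorem treeTheta_ofNat_mul (c : ℕ) [c.AtLeastTwo] (g : ℝ⟦X⟧) :
    treeTheta (ofNat(c) * g) = ofNat(c) * treeTheta g := by
  rw [← Nat.cast_ofNat, ← nsmul_eq_mul, map_nsmul, nsmul_eq_mul]

theorem coeff_ofNat_mul (n c : ℕ) [c.AtLeastTwo] (g : ℝ⟦X⟧) :
    coeff n (ofNat(c) * g) = ofNat(c) * coeff n g := by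
  rw [← Nat.cast_ofNat, ← nsmul_eq_mul, map_nsmul, nsmul_eq_mul, Nat.cast_ofNat]

/-- The moment generating functions as functions of the tree function `T`: the `j`-th one is
`treeMoment j` evaluated at `T`. They are polynomials in `1 / (1 - T)` except for `j = 0`; the value
`0` for `j > 4` is a placeholder. -/
noncomputable def treeMoment : ℕ → ℝ⟦X⟧
  | 0 => X
  | 1 => geom ^ 2 - 2 * geom + 1
  | 2 => 5 * geom ^ 5 - 14 * geom ^ 4 + 13 * geom ^ 3 - 4 * geom ^ 2
  | 3 => 90 * geom ^ 8 - 353 * geom ^ 7 + 536 * geom ^ 6 - 389 * geom ^ 5 + 132 * geom ^ 4 -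
    16 * geom ^ 3
  | 4 => 3315 * geom ^ 11 - 16771 * geom ^ 10 + 35171 * geom ^ 9 - 39290 * geom ^ 8 +
    24926 * geom ^ 7 - 8797 * geom ^ 6 + 1542 * geom ^ 5 - 96 * geom ^ 4
  | _ => 0

/-! The iterates of `treeTheta` on `treeMoment` that occur in the moment equations. -/

theorem treeTheta_iterate_treeMoment_zero_1 :
    treeTheta^[1] (treeMoment 0) = geom - 1 := by
  rw [Function.iterate_one, treeMoment, treeTheta_X]

theorem treeTheta_iterate_treeMoment_zero_2 :
    treeTheta^[2] (treeMoment 0) = geom ^ 3 - geom ^ 2 := by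
  rw [Function.iterate_succ_apply', treeTheta_iterate_treeMoment_zero_1]
  simp only [map_sub, treeTheta_geom, Derivation.map_one_eq_zero]
  ring

theorem treeTheta_iterate_treeMoment_zero_3 :
    treeTheta^[3] (treeMoment 0) = 3 * geom ^ 5 - 5 * geom ^ 4 + 2 * geom ^ 3 := by
  rw [Function.iterate_succ_apply', treeTheta_iterate_treeMoment_zero_2]
  simp only [map_sub, treeTheta_geom_pow]
  push_cast
  ring

theorem treeTheta_iterate_treeMoment_zero_4 :
    treeTheta^[4] (treeMoment 0) = 15 * geom ^ 7 - 35 * geom ^ 6 + 26 * geom ^ 5 - 6 * geom ^ 4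
      := by
  rw [Function.iterate_succ_apply', treeTheta_iterate_treeMoment_zero_3]
  simp only [map_add, map_sub, treeTheta_ofNat_mul, treeTheta_geom_pow]
  push_cast
  ring

theorem treeTheta_iterate_treeMoment_zero_5 :
    treeTheta^[5] (treeMoment 0) = 105 * geom ^ 9 - 315 * geom ^ 8 + 340 * geom ^ 7 -
      154 * geom ^ 6 + 24 * geom ^ 5 := by
  rw [Function.iterate_succ_apply', treeTheta_iterate_treeMoment_zero_4]
  simp only [map_add, map_sub, treeTheta_ofNat_mul, treeTheta_geom_pow]
  push_cast
  ring

theorem treeTheta_iterate_treeMoment_one_1 :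
    treeTheta^[1] (treeMoment 1) = 2 * geom ^ 4 - 4 * geom ^ 3 + 2 * geom ^ 2 := by
  rw [Function.iterate_one, treeMoment]
  simp only [map_add, map_sub, treeTheta_ofNat_mul, treeTheta_geom_pow, treeTheta_geom,
    Derivation.map_one_eq_zero]
  push_cast
  ring

theorem treeTheta_iterate_treeMoment_one_2 :
    treeTheta^[2] (treeMoment 1) = 8 * geom ^ 6 - 20 * geom ^ 5 + 16 * geom ^ 4 - 4 * geom ^ 3
      := by
  rw [Function.iterate_succ_apply', treeTheta_iterate_treeMoment_one_1]
  simp only [map_add, map_sub, treeTheta_ofNat_mul, treeTheta_geom_pow]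
  push_cast
  ring

theorem treeTheta_iterate_treeMoment_one_3 :
    treeTheta^[3] (treeMoment 1) = 48 * geom ^ 8 - 148 * geom ^ 7 + 164 * geom ^ 6 -
      76 * geom ^ 5 + 12 * geom ^ 4 := by
  rw [Function.iterate_succ_apply', treeTheta_iterate_treeMoment_one_2]
  simp only [map_add, map_sub, treeTheta_ofNat_mul, treeTheta_geom_pow]
  push_cast
  ring

theorem treeTheta_iterate_treeMoment_one_4 :
    treeTheta^[4] (treeMoment 1) = 384 * geom ^ 10 - 1420 * geom ^ 9 + 2020 * geom ^ 8 -
      1364 * geom ^ 7 + 428 * geom ^ 6 - 48 * geom ^ 5 := by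
  rw [Function.iterate_succ_apply', treeTheta_iterate_treeMoment_one_3]
  simp only [map_add, map_sub, treeTheta_ofNat_mul, treeTheta_geom_pow]
  push_cast
  ring

theorem treeTheta_iterate_treeMoment_two_1 :
    treeTheta^[1] (treeMoment 2) = 25 * geom ^ 7 - 81 * geom ^ 6 + 95 * geom ^ 5 - 47 * geom ^ 4 +
      8 * geom ^ 3 := by
  rw [Function.iterate_one, treeMoment]
  simp only [map_add, map_sub, treeTheta_ofNat_mul, treeTheta_geom_pow]
  push_cast
  ring

theorem treeTheta_iterate_treeMoment_two_2 :
    treeTheta^[2] (treeMoment 2) = 175 * geom ^ 9 - 661 * geom ^ 8 + 961 * geom ^ 7 -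
      663 * geom ^ 6 + 212 * geom ^ 5 - 24 * geom ^ 4 := by
  rw [Function.iterate_succ_apply', treeTheta_iterate_treeMoment_two_1]
  simp only [map_add, map_sub, treeTheta_ofNat_mul, treeTheta_geom_pow]
  push_cast
  ring

theorem treeTheta_iterate_treeMoment_two_3 :
    treeTheta^[3] (treeMoment 2) = 1575 * geom ^ 11 - 6863 * geom ^ 10 + 12015 * geom ^ 9 -
      10705 * geom ^ 8 + 5038 * geom ^ 7 - 1156 * geom ^ 6 + 96 * geom ^ 5 := by
  rw [Function.iterate_succ_apply', treeTheta_iterate_treeMoment_two_2]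
  simp only [map_add, map_sub, treeTheta_ofNat_mul, treeTheta_geom_pow]
  push_cast
  ring

theorem treeTheta_iterate_treeMoment_three_1 :
    treeTheta^[1] (treeMoment 3) = 720 * geom ^ 10 - 3191 * geom ^ 9 + 5687 * geom ^ 8 -
      5161 * geom ^ 7 + 2473 * geom ^ 6 - 576 * geom ^ 5 + 48 * geom ^ 4 := by
  rw [Function.iterate_one, treeMoment]
  simp only [map_add, map_sub, treeTheta_ofNat_mul, treeTheta_geom_pow]
  push_cast
  ring

theorem treeTheta_iterate_treeMoment_three_2 :
    treeTheta^[2] (treeMoment 3) = 7200 * geom ^ 12 - 35919 * geom ^ 11 + 74215 * geom ^ 10 -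
      81623 * geom ^ 9 + 50965 * geom ^ 8 - 17718 * geom ^ 7 + 3072 * geom ^ 6 - 192 * geom ^ 5
      := by
  rw [Function.iterate_succ_apply', treeTheta_iterate_treeMoment_three_1]
  simp only [map_add, map_sub, treeTheta_ofNat_mul, treeTheta_geom_pow]
  push_cast
  ring

theorem treeTheta_iterate_treeMoment_four_1 :
    treeTheta^[1] (treeMoment 4) = 36465 * geom ^ 13 - 204175 * geom ^ 12 + 484249 * geom ^ 11 -
      630859 * geom ^ 10 + 488802 * geom ^ 9 - 227264 * geom ^ 8 + 60492 * geom ^ 7 -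
      8094 * geom ^ 6 + 384 * geom ^ 5 := by
  rw [Function.iterate_one, treeMoment]
  simp only [map_add, map_sub, treeTheta_ofNat_mul, treeTheta_geom_pow]
  push_cast
  ring

/-- The inner sum of the moment equations commutes with substitution of the tree function. -/
theorem theta_sum_lagrangeHom (f : ℕ → ℝ⟦X⟧) (a : ℕ) :
    theta (∑ i ∈ Finset.range (a + 1),
      (a.choose i : ℝ⟦X⟧) * theta^[a - i] (lagrangeHom (f i))) =
    lagrangeHom (∑ i ∈ Finset.range (a + 1),
      (a.choose i : ℝ⟦X⟧) * treeTheta^[a - i + 1] (f i)) := by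
  rw [map_sum, map_sum]
  refine Finset.sum_congr rfl fun i _ => ?_
  rw [← nsmul_eq_mul, map_nsmul, theta_iterate_lagrangeHom, theta_lagrangeHom, nsmul_eq_mul,
    map_mul, map_natCast, Function.iterate_succ_apply']

/-- The moment equations hold for `treeMoment` before the tree function is substituted. They are
polynomial identities in `geom = 1 / (1 - X)` and `X`, modulo `X * geom = geom - 1`. -/
theorem treeTheta_treeMoment_sub_self (j : ℕ) (hj : j ≤ 4) :
    treeTheta (treeMoment j) - treeMoment j = ∑ a ∈ Finset.range (j + 1), (j.choose a : ℝ⟦X⟧) *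
      (∑ i ∈ Finset.range (a + 1), (a.choose i : ℝ⟦X⟧) * treeTheta^[a - i + 1] (treeMoment i)) *
        treeMoment (j - a) := by
  have c43 : Nat.choose 4 3 = 4 := rfl
  have c42 : Nat.choose 4 2 = 6 := rfl
  have c32 : Nat.choose 3 2 = 3 := rfl
  change treeTheta^[1] (treeMoment j) - _ = _
  interval_cases j <;>
    simp only [Finset.sum_range_succ, Finset.sum_range_zero, Nat.reduceAdd, Nat.reduceSub,
      Nat.choose_self, Nat.choose_zero_right, Nat.choose_one_right, c43, c42, c32,
      treeTheta_iterate_treeMoment_zero_1, treeTheta_iterate_treeMoment_zero_2,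
      treeTheta_iterate_treeMoment_zero_3, treeTheta_iterate_treeMoment_zero_4,
      treeTheta_iterate_treeMoment_zero_5, treeTheta_iterate_treeMoment_one_1,
      treeTheta_iterate_treeMoment_one_2, treeTheta_iterate_treeMoment_one_3,
      treeTheta_iterate_treeMoment_one_4, treeTheta_iterate_treeMoment_two_1,
      treeTheta_iterate_treeMoment_two_2, treeTheta_iterate_treeMoment_two_3,
      treeTheta_iterate_treeMoment_three_1, treeTheta_iterate_treeMoment_three_2,
      treeTheta_iterate_treeMoment_four_1]
  all_goals simp only [treeMoment]; push_cast
  -- `X` enters through `treeMoment 0` in the term `a = j`; its cofactor there is `geom` times the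
  -- polynomial given below
  · linear_combination -(1) * X_mul_geom
  · linear_combination -(2 * geom ^ 3 - 3 * geom ^ 2 + geom) * X_mul_geom
  · linear_combination -(25 * geom ^ 6 - 65 * geom ^ 5 + 58 * geom ^ 4 - 20 * geom ^ 3 +
      2 * geom ^ 2) * X_mul_geom
  · linear_combination -(720 * geom ^ 9 - 2666 * geom ^ 8 + 3848 * geom ^ 7 - 2707 * geom ^ 6 +
      941 * geom ^ 5 - 142 * geom ^ 4 + 6 * geom ^ 3) * X_mul_geom
  · linear_combination -(36465 * geom ^ 12 - 175375 * geom ^ 11 + 350023 * geom ^ 10 -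
      373641 * geom ^ 9 + 228825 * geom ^ 8 - 79869 * geom ^ 7 + 14732 * geom ^ 6 -
      1184 * geom ^ 5 + 24 * geom ^ 4) * X_mul_geom

theorem isMomentSystem_lagrangeHom : IsMomentSystem (fun j => lagrangeHom (treeMoment j)) 4 where
  coeff_zero j hj := by
    rw [coeff_zero_lagrangeHom]
    interval_cases j <;>
      simp only [treeMoment, coeff_zero_eq_constantCoeff_apply, map_add, map_sub, map_mul, map_pow,
        map_ofNat, constantCoeff_geom, map_one, constantCoeff_X] <;>
      norm_num
  coeff_one j hj := by
    rw [coeff_one_lagrangeHom]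
    have hg : coeff 1 geom = 1 := by simpa using coeff_one_geom_pow 1
    interval_cases j <;>
      simp only [treeMoment, map_add, map_sub, coeff_ofNat_mul, coeff_one_geom_pow, hg,
        coeff_one_X, coeff_one] <;>
      norm_num
  eqn j hj := by
    have h := congrArg lagrangeHom (treeTheta_treeMoment_sub_self j hj)
    rw [map_sub, ← theta_lagrangeHom, map_sum] at h
    rw [h]
    refine Finset.sum_congr rfl fun a _ => ?_
    rw [theta_sum_lagrangeHom, map_mul, map_mul, map_natCast]

end PowerSeries

/-! ### Exact moments -/

namespace PointedTree

open PowerSeries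

theorem momentSeries_eq (j : ℕ) (hj : j ≤ 4) :
    momentSeries j = lagrangeHom (treeMoment j) :=
  (isMomentSystem_momentSeries 4).unique isMomentSystem_lagrangeHom j hj

/-- The partial exponential sum in the coefficients of `1 / (1 - T) ^ 2`, in terms of `W n`. -/
theorem mul_sum_range_eq_W (n : ℕ) (hn : 1 ≤ n) :
    n * ∑ k ∈ Finset.range (n + 1), (n : ℝ) ^ k / k ! =
      (n : ℝ) ^ n / n ! * (RootedLabeledTree.W n + 2 * n) := by
  obtain ⟨m, rfl⟩ := Nat.exists_eq_add_of_le' hn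
  have hm : ((m : ℝ) + 1) ≠ 0 := by positivity
  have hf : (m ! : ℝ) ≠ 0 := by exact_mod_cast m.factorial_ne_zero
  rw [Finset.sum_range_succ, Finset.sum_range_succ, RootedLabeledTree.W, Nat.add_sub_cancel,
    Nat.factorial_succ]
  push_cast
  field_simp
  ring

theorem powerSum_eq_coeff (j n : ℕ) (hj : j ≤ 4) :
    powerSum j n = n ! * coeff n (lagrangeHom (treeMoment j)) := by
  have hf : (n ! : ℝ) ≠ 0 := by exact_mod_cast n.factorial_ne_zero
  rw [← momentSeries_eq j hj, momentSeries, coeff_mk]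
  field_simp

/-- Cayley's formula for rooted trees. -/
theorem mul_powerSum_zero (n : ℕ) (hn : 1 ≤ n) : n * powerSum 0 n = (n : ℝ) ^ n := by
  have hf : (n ! : ℝ) ≠ 0 := by exact_mod_cast n.factorial_ne_zero
  rw [powerSum_eq_coeff 0 n (by lia), treeMoment, mul_left_comm, coeff_lagrangeHom_X (by lia)]
  field_simp

/-- The first four moments of the total height about the origin, as multiples of the number of
rooted trees. -/
theorem powerSum_eq (n : ℕ) (hn : 1 ≤ n) :
    powerSum 1 n = powerSum 0 n * RootedLabeledTree.W n ∧
    powerSum 2 n = powerSum 0 n *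
      (5 / 3 * (n : ℝ) ^ 3 - 5 / 3 * n ^ 2 - 17 / 6 * n * RootedLabeledTree.W n) ∧
    powerSum 3 n = powerSum 0 n *
      (-151 / 30 * (n : ℝ) ^ 4 + 76 / 15 * n ^ 3 - 1 / 30 * n ^ 2 +
        (15 / 8 * n ^ 3 + 157 / 24 * n ^ 2 - 1 / 60 * n) * RootedLabeledTree.W n) ∧
    powerSum 4 n = powerSum 0 n *
      (221 / 63 * (n : ℝ) ^ 6 + 4693 / 540 * n ^ 5 - 4651 / 378 * n ^ 4 + 109 / 1260 * n ^ 3 +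
        2 / 105 * n ^ 2 + (-577 / 48 * n ^ 4 - 6121 / 432 * n ^ 3 + 97 / 2520 * n ^ 2 +
          1 / 105 * n) * RootedLabeledTree.W n) := by
  have hn0 : (n : ℝ) ≠ 0 := by exact_mod_cast (by lia : n ≠ 0)
  have hf : (n ! : ℝ) ≠ 0 := by exact_mod_cast n.factorial_ne_zero
  have h0 := mul_powerSum_zero n hn
  have hW := mul_sum_range_eq_W n hn
  have h1 := coeff_lagrangeHom_geom n
  have h2 := coeff_lagrangeHom_geom_sq n
  rw [← h2, ← h1] at hW
  have h3 := coeff_lagrangeHom_geom_pow_add_two 1 n (by lia)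
  have h4 := coeff_lagrangeHom_geom_pow_add_two 2 n (by lia)
  have h5 := coeff_lagrangeHom_geom_pow_add_two 3 n (by lia)
  have h6 := coeff_lagrangeHom_geom_pow_add_two 4 n (by lia)
  have h7 := coeff_lagrangeHom_geom_pow_add_two 5 n (by lia)
  have h8 := coeff_lagrangeHom_geom_pow_add_two 6 n (by lia)
  have h9 := coeff_lagrangeHom_geom_pow_add_two 7 n (by lia)
  have h10 := coeff_lagrangeHom_geom_pow_add_two 8 n (by lia)
  have h11 := coeff_lagrangeHom_geom_pow_add_two 9 n (by lia)
  have hone : coeff n (lagrangeHom 1) = 0 := by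
    rw [map_one, coeff_one, if_neg (by lia)]
  have hnat (c : ℕ) [c.AtLeastTwo] (g : ℝ⟦X⟧) :
      coeff n (lagrangeHom (ofNat(c) * g)) = ofNat(c) * coeff n (lagrangeHom g) := by
    rw [map_mul, map_ofNat, coeff_ofNat_mul]
  -- the number of rooted trees divided by `n!`
  have hN : powerSum 0 n = n ! * (coeff n (lagrangeHom geom) / n) := by
    rw [h1]
    field_simp
    linear_combination h0
  -- the coefficient of `1 / (1 - T) ^ 2` in terms of `W n`
  have hb : coeff n (lagrangeHom (geom ^ 2)) =
      coeff n (lagrangeHom geom) / n * (RootedLabeledTree.W n + 2 * n) := by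
    field_simp
    linear_combination hW
  simp only [Nat.reduceAdd, pow_one, Nat.cast_one, Nat.cast_ofNat] at h3 h4 h5 h6 h7 h8 h9 h10 h11
  rw [powerSum_eq_coeff 1 n (by lia), powerSum_eq_coeff 2 n (by lia),
    powerSum_eq_coeff 3 n (by lia), powerSum_eq_coeff 4 n le_rfl, hN]
  simp only [treeMoment, map_add, map_sub, hnat, hone, h11, h10, h9, h8, h7, h6, h5, h4, h3, hb,
    mul_assoc]
  clear h0 hW h1 h2 h3 h4 h5 h6 h7 h8 h9 h10 h11 hone hnat hN hb
  refine ⟨?_, ?_, ?_, ?_⟩ <;> field_simp <;> ring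

end PointedTree

namespace RootedLabeledTree

open MeasureTheory

/-- Rooted labeled trees are the rooted trees with vertex type `Fin n`. -/
def equivPointedTree (n : ℕ) : RootedLabeledTree n ≃ PointedTree (Fin n) where
  toFun T := ⟨T.graph, T.root, T.isTree⟩
  invFun T := ⟨T.graph, T.root, T.isTree⟩
  left_inv _ := rfl
  right_inv _ := rfl

noncomputable instance (n : ℕ) : Fintype (RootedLabeledTree n) :=
  Fintype.ofEquiv _ (equivPointedTree n).symm

instance (n : ℕ) : MeasurableSingletonClass (RootedLabeledTree n) := ⟨fun _ => trivial⟩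

theorem sum_totalHeight (n : ℕ) (g : ℕ → ℝ) :
    ∑ T : RootedLabeledTree n, g T.totalHeight = PointedTree.heightSum (Fin n) g :=
  Fintype.sum_equiv (equivPointedTree n) _ _ fun _ => rfl

theorem card_eq_powerSum_zero (n : ℕ) :
    (Fintype.card (RootedLabeledTree n) : ℝ) = PointedTree.powerSum 0 n := by
  simpa [PointedTree.powerSum] using sum_totalHeight n fun _ => 1

theorem integral_uniform (n : ℕ) (g : ℕ → ℝ) :
    ∫ T, g (totalHeight T) ∂uniform n =
      PointedTree.heightSum (Fin n) g / PointedTree.powerSum 0 n := by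
  rw [uniform, uniformOn, ProbabilityTheory.cond, Measure.restrict_univ,
    integral_smul_measure, integral_count, sum_totalHeight, ← card_eq_powerSum_zero,
    Measure.count_univ]
  simp [div_eq_inv_mul]

/-- There are rooted trees on `n ≥ 1` labels, so division by their number is harmless. -/
theorem powerSum_zero_ne_zero {n : ℕ} (hn : 1 ≤ n) : PointedTree.powerSum 0 n ≠ 0 := fun h => by
  have := PointedTree.mul_powerSum_zero n hn
  rw [h, mul_zero] at this
  exact pow_ne_zero n (by exact_mod_cast (by lia : n ≠ 0) : (n : ℝ) ≠ 0) this.symm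

theorem integral_totalHeight {n : ℕ} (hn : 1 ≤ n) :
    ∫ T, (totalHeight T : ℝ) ∂uniform n = W n := by
  have h : (PointedTree.heightSum (Fin n) fun h => (h : ℝ)) = PointedTree.powerSum 1 n := by
    simp [PointedTree.powerSum]
  rw [integral_uniform n fun h => (h : ℝ), h, (PointedTree.powerSum_eq n hn).1,
    mul_div_cancel_left₀ _ (powerSum_zero_ne_zero hn)]

theorem heightCentralMoment_eq {n : ℕ} (hn : 1 ≤ n) (k : ℕ) :
    heightCentralMoment n k =
      (PointedTree.heightSum (Fin n) fun h => ((h : ℝ) - W n) ^ k) / PointedTree.powerSum 0 n := by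
  rw [heightCentralMoment, centralMoment, integral_totalHeight hn]
  exact integral_uniform n fun h => ((h : ℝ) - W n) ^ k

theorem heightCentralMoment_two {n : ℕ} (hn : 1 ≤ n) :
    heightCentralMoment n 2 =
      5 / 3 * (n : ℝ) ^ 3 - 5 / 3 * n ^ 2 - 17 / 6 * n * W n - W n ^ 2 := by
  obtain ⟨h1, h2, -, -⟩ := PointedTree.powerSum_eq n hn
  have h0 := powerSum_zero_ne_zero hn
  have h : (PointedTree.heightSum (Fin n) fun h => ((h : ℝ) - W n) ^ 2) =
      PointedTree.powerSum 2 n - 2 * W n * PointedTree.powerSum 1 n +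
        W n ^ 2 * PointedTree.powerSum 0 n := by
    simp only [PointedTree.powerSum, PointedTree.heightSum, Finset.mul_sum]
    rw [← Finset.sum_sub_distrib, ← Finset.sum_add_distrib]
    exact Finset.sum_congr rfl fun T _ => by ring
  rw [heightCentralMoment_eq hn, h, h1, h2]
  field_simp
  ring

theorem heightCentralMoment_four {n : ℕ} (hn : 1 ≤ n) :
    heightCentralMoment n 4 =
      -3 * W n ^ 4 - 17 * (n : ℝ) * W n ^ 3
        + (5 / 2 * (n : ℝ) ^ 3 - 217 / 6 * (n : ℝ) ^ 2 + 1 / 15 * (n : ℝ)) * W n ^ 2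
        + (649 / 80 * (n : ℝ) ^ 4 - 74381 / 2160 * (n : ℝ) ^ 3 + 433 / 2520 * (n : ℝ) ^ 2
            + 1 / 105 * (n : ℝ)) * W n
        + 221 / 63 * (n : ℝ) ^ 6 + 4693 / 540 * (n : ℝ) ^ 5 - 4651 / 378 * (n : ℝ) ^ 4
        + 109 / 1260 * (n : ℝ) ^ 3 + 2 / 105 * (n : ℝ) ^ 2 := by
  obtain ⟨h1, h2, h3, h4⟩ := PointedTree.powerSum_eq n hn
  have h0 := powerSum_zero_ne_zero hn
  have h : (PointedTree.heightSum (Fin n) fun h => ((h : ℝ) - W n) ^ 4) =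
      PointedTree.powerSum 4 n - 4 * W n * PointedTree.powerSum 3 n +
        6 * W n ^ 2 * PointedTree.powerSum 2 n - 4 * W n ^ 3 * PointedTree.powerSum 1 n +
        W n ^ 4 * PointedTree.powerSum 0 n := by
    simp only [PointedTree.powerSum, PointedTree.heightSum, Finset.mul_sum]
    rw [← Finset.sum_sub_distrib, ← Finset.sum_add_distrib, ← Finset.sum_sub_distrib,
      ← Finset.sum_add_distrib]
    exact Finset.sum_congr rfl fun T _ => by ring
  rw [heightCentralMoment_eq hn, h, h1, h2, h3, h4]
  field_simp
  ring

theorem variance_eq_heightCentralMoment (n : ℕ) :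
    variance (fun T : RootedLabeledTree n => (T.totalHeight : ℝ)) (uniform n) =
      heightCentralMoment n 2 := by
  rw [heightCentralMoment, centralMoment_two_eq_variance]
  exact measurable_from_top.aemeasurable

end RootedLabeledTree

/-! ### Asymptotics of the mean -/

namespace RootedLabeledTree

open MeasureTheory Set Real Topology

theorem integrableOn_exp_neg_mul_pow (j : ℕ) :
    IntegrableOn (fun t : ℝ => exp (-t) * t ^ j) (Ioi 0) := by
  have := Real.GammaIntegral_convergent (s := j + 1) (by positivity)
  simpa using this

theorem integral_exp_neg_mul_pow (j : ℕ) : ∫ t in Ioi (0 : ℝ), exp (-t) * t ^ j = j ! := by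
  have := Real.Gamma_eq_integral (s := j + 1) (by positivity)
  rw [Real.Gamma_nat_eq_factorial] at this
  simpa using this.symm

/-- Ramanujan's integral for the partial sums of the exponential series. -/
theorem integral_exp_neg_mul_one_add_div_pow {n : ℕ} (hn : 1 ≤ n) :
    ∫ t in Ioi (0 : ℝ), exp (-t) * (1 + t / n) ^ n = W n / n + 2 := by
  have hn0 : (n : ℝ) ≠ 0 := by exact_mod_cast (by lia : n ≠ 0)
  have hf : (n ! : ℝ) ≠ 0 := by exact_mod_cast n.factorial_ne_zero
  have h1 (t : ℝ) : exp (-t) * (1 + t / n) ^ n = ∑ k ∈ Finset.range (n + 1),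
      (n.choose k / (n : ℝ) ^ (n - k)) * (exp (-t) * t ^ (n - k)) := by
    rw [add_pow, Finset.mul_sum]
    refine Finset.sum_congr rfl fun k _ => ?_
    rw [div_pow, one_pow]
    ring
  have h2 := PointedTree.mul_sum_range_eq_W n hn
  have h3 : W n / n + 2 = (n ! : ℝ) / n ^ n * ∑ k ∈ Finset.range (n + 1), (n : ℝ) ^ k / k ! := by
    field_simp at h2 ⊢
    linear_combination -h2
  simp_rw [h1]
  rw [integral_finsetSum _ fun k _ => (integrableOn_exp_neg_mul_pow _).const_mul _, h3,
    Finset.mul_sum]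
  refine Finset.sum_congr rfl fun k hk => ?_
  have hk' : k ≤ n := by simpa [Nat.lt_succ_iff] using hk
  have hkf : (k ! : ℝ) ≠ 0 := by exact_mod_cast k.factorial_ne_zero
  have hnk : ((n - k)! : ℝ) ≠ 0 := by exact_mod_cast (n - k).factorial_ne_zero
  rw [integral_const_mul, integral_exp_neg_mul_pow, Nat.cast_choose ℝ hk']
  have hp : (n : ℝ) ^ n = n ^ (n - k) * n ^ k := by rw [← pow_add, Nat.sub_add_cancel hk']
  rw [hp]
  field_simp

/-- The integrand of Ramanujan's integral after the substitution `t = s √n`. -/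
noncomputable def scaledIntegrand (n : ℕ) (s : ℝ) : ℝ :=
  exp (-(s * √n)) * (1 + s / √n) ^ n

theorem integral_scaledIntegrand {n : ℕ} (hn : 1 ≤ n) :
    ∫ s in Ioi (0 : ℝ), scaledIntegrand n s = (W n / n + 2) / √n := by
  have hn0 : (0 : ℝ) < n := by exact_mod_cast hn
  have h := integral_comp_mul_left_Ioi (fun t : ℝ => exp (-t) * (1 + t / n) ^ n) 0
    (Real.sqrt_pos.2 hn0)
  rw [mul_zero, integral_exp_neg_mul_one_add_div_pow hn, smul_eq_mul] at h
  rw [div_eq_inv_mul, ← h]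
  congr 1 with s
  rw [scaledIntegrand, mul_comm s]
  congr 3
  nth_rw 3 [← Real.mul_self_sqrt hn0.le]
  field_simp

/-- This is `t ≤ sinh t` at `t = log (1 + x)`. -/
theorem log_one_add_le {x : ℝ} (hx : 0 ≤ x) : log (1 + x) ≤ x - x ^ 2 / (2 * (1 + x)) := by
  have h := Real.self_le_sinh_iff.2 (Real.log_nonneg (by linarith : 1 ≤ 1 + x))
  rw [Real.sinh_log (by linarith)] at h
  refine h.trans (le_of_eq ?_)
  field_simp
  ring

theorem scaledIntegrand_eq_exp {n : ℕ} (hn : 1 ≤ n) {s : ℝ} (hs : 0 ≤ s) :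
    scaledIntegrand n s = exp (n * log (1 + s / √n) - s * √n) := by
  have hn0 : (0 : ℝ) < √n := Real.sqrt_pos.2 (by exact_mod_cast hn)
  rw [scaledIntegrand, sub_eq_neg_add, exp_add, mul_comm (n : ℝ), exp_mul, exp_log (by positivity),
    rpow_natCast]

theorem scaledIntegrand_le {n : ℕ} (hn : 1 ≤ n) {s : ℝ} (hs : 0 ≤ s) :
    scaledIntegrand n s ≤ exp (-(s ^ 2 / (2 * (1 + s / √n)))) := by
  have hn1 : (0 : ℝ) < n := by exact_mod_cast hn
  have hn0 : (0 : ℝ) < √n := Real.sqrt_pos.2 hn1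
  rw [scaledIntegrand_eq_exp hn hs, exp_le_exp]
  have h := mul_le_mul_of_nonneg_left (log_one_add_le (div_nonneg hs hn0.le)) hn1.le
  have e : (n : ℝ) * (s / √n - (s / √n) ^ 2 / (2 * (1 + s / √n))) =
      s * √n - s ^ 2 / (2 * (1 + s / √n)) := by
    have hpos : 0 < 1 + s / √n := by positivity
    generalize hc : 1 + s / √n = c at *
    have := Real.mul_self_sqrt hn1.le
    field_simp
    rw [Real.sq_sqrt hn1.le]
    ring
  rw [e] at h
  linarith

theorem le_scaledIntegrand {n : ℕ} (hn : 1 ≤ n) {s : ℝ} (hs : 0 ≤ s) :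
    exp (-(s ^ 2 / (2 + s / √n))) ≤ scaledIntegrand n s := by
  have hn1 : (0 : ℝ) < n := by exact_mod_cast hn
  have hn0 : (0 : ℝ) < √n := Real.sqrt_pos.2 hn1
  rw [scaledIntegrand_eq_exp hn hs, exp_le_exp]
  have h := mul_le_mul_of_nonneg_left
    (Real.le_log_one_add_of_nonneg (div_nonneg hs hn0.le)) hn1.le
  have e : (n : ℝ) * (2 * (s / √n) / (s / √n + 2)) = s * √n - s ^ 2 / (2 + s / √n) := by
    have hpos : 0 < 2 + s / √n := by positivity
    rw [add_comm _ (2 : ℝ)]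
    have hc : s / √n = (2 + s / √n) - 2 := by ring
    have hr : (n : ℝ) = √n * √n := (Real.mul_self_sqrt hn1.le).symm
    have h2 : s * √n = n * (s / √n) := by
      nth_rw 2 [hr]
      field_simp
    have h3 : s ^ 2 = n * (s / √n) ^ 2 := by
      nth_rw 1 [hr]
      field_simp
    rw [h2, h3]
    field_simp
    ring
  rw [e] at h
  linarith

theorem tendsto_one_div_sqrt_natCast : Tendsto (fun n : ℕ => 1 / √(n : ℝ)) atTop (𝓝 0) := by
  simp_rw [one_div]
  exact (Real.tendsto_sqrt_atTop.comp tendsto_natCast_atTop_atTop).inv_tendsto_atTop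

theorem tendsto_scaledIntegrand {s : ℝ} (hs : 0 ≤ s) :
    Tendsto (fun n => scaledIntegrand n s) atTop (𝓝 (exp (-(1 / 2) * s ^ 2))) := by
  have h0 : Tendsto (fun n : ℕ => s / √(n : ℝ)) atTop (𝓝 0) := by
    simpa [div_eq_mul_inv] using tendsto_one_div_sqrt_natCast.const_mul s
  have hu : Tendsto (fun n : ℕ => exp (-(s ^ 2 / (2 * (1 + s / √(n : ℝ)))))) atTop
      (𝓝 (exp (-(s ^ 2 / (2 * (1 + 0)))))) :=
    (Real.continuous_exp.tendsto _).comp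
      ((tendsto_const_nhds.div ((h0.const_add 1).const_mul 2) (by norm_num)).neg)
  have hl : Tendsto (fun n : ℕ => exp (-(s ^ 2 / (2 + s / √(n : ℝ))))) atTop
      (𝓝 (exp (-(s ^ 2 / (2 + 0))))) :=
    (Real.continuous_exp.tendsto _).comp
      ((tendsto_const_nhds.div (h0.const_add 2) (by norm_num)).neg)
  have e1 : -(s ^ 2 / (2 * (1 + 0))) = -(1 / 2) * s ^ 2 := by ring
  have e2 : -(s ^ 2 / (2 + 0)) = -(1 / 2) * s ^ 2 := by ring
  rw [e1] at hu
  rw [e2] at hl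
  refine tendsto_of_tendsto_of_tendsto_of_le_of_le' hl hu ?_ ?_
  · filter_upwards [eventually_ge_atTop 1] with n hn using le_scaledIntegrand hn hs
  · filter_upwards [eventually_ge_atTop 1] with n hn using scaledIntegrand_le hn hs

/-- The integrable bound, uniform in `n`, for dominated convergence. -/
theorem scaledIntegrand_le_bound {n : ℕ} (hn : 1 ≤ n) {s : ℝ} (hs : 0 ≤ s) :
    scaledIntegrand n s ≤ exp (1 / 2) * exp (-(1 / 2) * s) := by
  refine (scaledIntegrand_le hn hs).trans ?_
  rw [← exp_add, exp_le_exp]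
  have hn0 : (1 : ℝ) ≤ √n := Real.one_le_sqrt.2 (by exact_mod_cast hn)
  have h1 : s / √n ≤ s := div_le_self hs hn0
  have h2 : s ^ 2 / (2 * (1 + s)) ≤ s ^ 2 / (2 * (1 + s / √n)) := by gcongr
  have h3 : (s - 1) / 2 ≤ s ^ 2 / (2 * (1 + s)) := by
    rw [div_le_div_iff₀ (by norm_num) (by positivity)]
    nlinarith
  linarith

theorem tendsto_integral_scaledIntegrand :
    Tendsto (fun n => ∫ s in Ioi (0 : ℝ), scaledIntegrand n s) atTop (𝓝 (√(2 * π) / 2)) := by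
  have hg : ∫ s in Ioi (0 : ℝ), exp (-(1 / 2) * s ^ 2) = √(2 * π) / 2 := by
    rw [integral_gaussian_Ioi, div_div_eq_mul_div, div_one, mul_comm]
  rw [← hg]
  refine tendsto_integral_filter_of_dominated_convergence
    (fun s => exp (1 / 2) * exp (-(1 / 2) * s)) ?_ ?_ ?_ ?_
  · refine Eventually.of_forall fun n => Continuous.aestronglyMeasurable ?_
    unfold scaledIntegrand
    fun_prop
  · filter_upwards [eventually_ge_atTop 1] with n hn
    filter_upwards [ae_restrict_mem measurableSet_Ioi] with s hs
    have hs' : (0 : ℝ) ≤ s := le_of_lt hs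
    rw [Real.norm_of_nonneg (by rw [scaledIntegrand_eq_exp hn hs']; positivity)]
    exact scaledIntegrand_le_bound hn hs'
  · exact (integrableOn_exp_mul_Ioi (by norm_num) 0).const_mul _
  · filter_upwards [ae_restrict_mem measurableSet_Ioi] with s hs
    exact tendsto_scaledIntegrand (le_of_lt hs)

/-- `W n` is asymptotic to `√(π / 2) n ^ (3 / 2)`. -/
theorem tendsto_W_div :
    Tendsto (fun n : ℕ => W n / (n * √n)) atTop (𝓝 (√(2 * π) / 2)) := by
  have h := tendsto_integral_scaledIntegrand.sub (tendsto_one_div_sqrt_natCast.const_mul 2)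
  rw [mul_zero, sub_zero] at h
  refine h.congr' ?_
  filter_upwards [eventually_ge_atTop 1] with n hn
  have hn1 : (0 : ℝ) < n := by exact_mod_cast hn
  have hn0 : (0 : ℝ) < √n := Real.sqrt_pos.2 hn1
  rw [integral_scaledIntegrand hn]
  field_simp
  ring

end RootedLabeledTree

/-! ### Limits of the central moments -/

namespace RootedLabeledTree

open Real Topology

/-- The quotient is a polynomial in `W n / n ^ (3 / 2)` and `1 / √n`, which converge. -/
theorem tendsto_heightCentralMoment_two :
    Tendsto (fun n : ℕ => heightCentralMoment n 2 / (n : ℝ) ^ 3) atTop (𝓝 (5 / 3 - π / 2)) := by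
  have hF : Continuous fun p : ℝ × ℝ =>
      5 / 3 - 5 / 3 * p.2 ^ 2 - 17 / 6 * p.1 * p.2 - p.1 ^ 2 := by fun_prop
  have h := (hF.tendsto _).comp (tendsto_W_div.prodMk_nhds tendsto_one_div_sqrt_natCast)
  have hpi : √(2 * π) ^ 2 = 2 * π := Real.sq_sqrt (by positivity)
  have hl : 5 / 3 - 5 / 3 * (0 : ℝ) ^ 2 - 17 / 6 * (√(2 * π) / 2) * 0 - (√(2 * π) / 2) ^ 2 =
      5 / 3 - π / 2 := by
    linear_combination -hpi / 4
  rw [hl] at h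
  refine h.congr' ?_
  filter_upwards [eventually_ge_atTop 1] with n hn
  have hn1 : (0 : ℝ) < n := by exact_mod_cast hn
  have hr0 : (0 : ℝ) < √n := Real.sqrt_pos.2 hn1
  have hr : (n : ℝ) = √n ^ 2 := (Real.sq_sqrt hn1.le).symm
  rw [heightCentralMoment_two hn]
  simp only [Function.comp_apply]
  generalize W n = w
  generalize √(n : ℝ) = r at hr hr0
  rw [hr]
  field_simp

theorem tendsto_heightCentralMoment_four :
    Tendsto (fun n : ℕ => heightCentralMoment n 4 / (n : ℝ) ^ 6) atTop
      (𝓝 (-(3 / 4) * π ^ 2 + 5 / 4 * π + 221 / 63)) := by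
  have hF : Continuous fun p : ℝ × ℝ =>
      -3 * p.1 ^ 4 - 17 * p.2 * p.1 ^ 3
        + (5 / 2 - 217 / 6 * p.2 ^ 2 + 1 / 15 * p.2 ^ 4) * p.1 ^ 2
        + (649 / 80 * p.2 - 74381 / 2160 * p.2 ^ 3 + 433 / 2520 * p.2 ^ 5
            + 1 / 105 * p.2 ^ 7) * p.1
        + 221 / 63 + 4693 / 540 * p.2 ^ 2 - 4651 / 378 * p.2 ^ 4
        + 109 / 1260 * p.2 ^ 6 + 2 / 105 * p.2 ^ 8 := by fun_prop
  have h := (hF.tendsto _).comp (tendsto_W_div.prodMk_nhds tendsto_one_div_sqrt_natCast)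
  have hpi : √(2 * π) ^ 2 = 2 * π := Real.sq_sqrt (by positivity)
  convert h.congr' ?_ using 2
  · linear_combination (3 / 16 * (√(2 * π) ^ 2 + 2 * π) - 5 / 8) * hpi
  filter_upwards [eventually_ge_atTop 1] with n hn
  have hn1 : (0 : ℝ) < n := by exact_mod_cast hn
  have hr0 : (0 : ℝ) < √n := Real.sqrt_pos.2 hn1
  have hr : (n : ℝ) = √n ^ 2 := (Real.sq_sqrt hn1.le).symm
  rw [heightCentralMoment_four hn]
  simp only [Function.comp_apply]
  generalize W n = w
  generalize √(n : ℝ) = r at hr hr0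
  rw [hr]
  field_simp

/-- The limit constant is `1.1 * 10 ^ (-9)` away from the decimal, so that many digits of `π` are
needed. -/
theorem abs_fourthMomentConst_sub_lt :
    |(-(3 / 4) * π ^ 2 + 5 / 4 * π + 221 / 63) - 0.032724023| < 0.000000002 := by
  have h1 := Real.pi_gt_d20
  have h2 := Real.pi_lt_d20
  rw [abs_lt]
  constructor <;> nlinarith

theorem ten_sub_three_mul_pi_ne_zero : 10 - 3 * π ≠ 0 := by
  have := Real.pi_lt_d2
  intro h
  linarith

theorem tendsto_heightKurtosis :
    Tendsto heightKurtosis atTop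
      (𝓝 (1 / 7 * ((-189 * π ^ 2 + 315 * π + 884) / (10 - 3 * π) ^ 2))) := by
  have hpi := ten_sub_three_mul_pi_ne_zero
  have hne : (5 / 3 - π / 2) ≠ 0 := fun h => hpi (by linear_combination 6 * h)
  have h := tendsto_heightCentralMoment_four.div (tendsto_heightCentralMoment_two.pow 2)
    (pow_ne_zero 2 hne)
  have hl : (-(3 / 4) * π ^ 2 + 5 / 4 * π + 221 / 63) / (5 / 3 - π / 2) ^ 2 =
      1 / 7 * ((-189 * π ^ 2 + 315 * π + 884) / (10 - 3 * π) ^ 2) := by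
    rw [show 5 / 3 - π / 2 = (10 - 3 * π) / 6 by ring]
    field_simp
    ring
  rw [hl] at h
  refine h.congr' ?_
  filter_upwards [eventually_ge_atTop 1] with n hn
  have hn0 : (n : ℝ) ≠ 0 := by exact_mod_cast (by lia : n ≠ 0)
  rw [heightKurtosis, variance_eq_heightCentralMoment, Pi.div_apply, div_pow, ← pow_mul,
    div_div_div_cancel_right₀ (pow_ne_zero 6 hn0)]

theorem abs_kurtosisLimit_sub_lt :
    |1 / 7 * ((-189 * π ^ 2 + 315 * π + 884) / (10 - 3 * π) ^ 2) - 3.5604| < 0.00005 := by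
  have h1 := Real.pi_gt_d20
  have h2 := Real.pi_lt_d20
  have h3 : 0 < (10 - 3 * π) ^ 2 := pow_pos (by linarith) 2
  rw [abs_lt, lt_sub_iff_add_lt, sub_lt_iff_lt_add, mul_div_assoc', lt_div_iff₀ h3, div_lt_iff₀ h3]
  constructor <;> nlinarith

end RootedLabeledTree

theorem theorem4 :
    -- the explicit formula
    (∀ n : ℕ, 1 ≤ n →
      RootedLabeledTree.heightCentralMoment n 4 =
        -3 * RootedLabeledTree.W n ^ 4
        - 17 * (n : ℝ) * RootedLabeledTree.W n ^ 3
        + (5 / 2 * (n : ℝ) ^ 3 - 217 / 6 * (n : ℝ) ^ 2 + 1 / 15 * (n : ℝ))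
            * RootedLabeledTree.W n ^ 2
        + (649 / 80 * (n : ℝ) ^ 4 - 74381 / 2160 * (n : ℝ) ^ 3 + 433 / 2520 * (n : ℝ) ^ 2
            + 1 / 105 * (n : ℝ)) * RootedLabeledTree.W n
        + 221 / 63 * (n : ℝ) ^ 6 + 4693 / 540 * (n : ℝ) ^ 5 - 4651 / 378 * (n : ℝ) ^ 4
        + 109 / 1260 * (n : ℝ) ^ 3 + 2 / 105 * (n : ℝ) ^ 2) ∧
    -- its asymptotics
    (fun n : ℕ => RootedLabeledTree.heightCentralMoment n 4) ~[atTop]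
      (fun n : ℕ => (-(3 / 4) * Real.pi ^ 2 + 5 / 4 * Real.pi + 221 / 63) * (n : ℝ) ^ 6) ∧
    |(-(3 / 4) * Real.pi ^ 2 + 5 / 4 * Real.pi + 221 / 63) - 0.032724023| < 0.000000002 ∧
    -- the limiting kurtosis
    Tendsto RootedLabeledTree.heightKurtosis atTop
      (nhds (1 / 7 * ((-189 * Real.pi ^ 2 + 315 * Real.pi + 884) / (10 - 3 * Real.pi) ^ 2))) ∧
    |1 / 7 * ((-189 * Real.pi ^ 2 + 315 * Real.pi + 884) / (10 - 3 * Real.pi) ^ 2) - 3.5604|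
      < 0.00005 ∧
    3 < 1 / 7 * ((-189 * Real.pi ^ 2 + 315 * Real.pi + 884) / (10 - 3 * Real.pi) ^ 2) := by
  have hc := RootedLabeledTree.abs_fourthMomentConst_sub_lt
  have hk := RootedLabeledTree.abs_kurtosisLimit_sub_lt
  refine ⟨fun n hn => RootedLabeledTree.heightCentralMoment_four hn, ?_, hc,
    RootedLabeledTree.tendsto_heightKurtosis, hk, by linarith [(abs_lt.1 hk).1]⟩
  have hne : -(3 / 4) * Real.pi ^ 2 + 5 / 4 * Real.pi + 221 / 63 ≠ 0 := by
    have := (abs_lt.1 hc).1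
    linarith
  refine isEquivalent_of_tendsto_one ?_
  have h := RootedLabeledTree.tendsto_heightCentralMoment_four.div_const
    (-(3 / 4) * Real.pi ^ 2 + 5 / 4 * Real.pi + 221 / 63)
  rw [div_self hne] at h
  refine h.congr fun n => ?_
  rw [Pi.div_apply, div_div, mul_comm]
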